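/- Let $\vec\xi(j)$ and $\vec\eta(j)$, $j\in\mathbb Z$, be uncorrelated zero-mean $\mathbb C^T$-valued stationary sequences with spectral densities $F,G$ on $(-\pi,\pi]$ (integrable, Hermitian positive semidefinite), so that $E\,\vec\xi(j+n)\vec\xi(j)^*=\frac1{2\pi}\int_{-\pi}^{\pi}e^{in\lambda}F(\lambda)\,d\lambda$ and likewise for $\vec\eta,G$. Assume the minimality condition: $F+G$ is invertible almost everywhere and $(F+G)^{-1}$ is integrable. Let $S=\bigcup_{l=1}^{s}\{-(M_l+N_l),\dots,-M_l\}$, $S^+=\bigcup_{l=1}^{s}\{M_l,\dots,M_l+N_l\}$, $\mathbb Z_-=\{-1,-2,\dots\}$, $Z^S=\{1,2,\dots\}\setminus S^+$, $U=S\cup\{0,1,2,\dots\}$. For coefficients $\vec a(j)\in\mathbb C^T$ and $N\ge 0$ consider $$A_N\vec\xi=\sum_{j\in Z^S\cap\{0,\dots,N\}}\vec a(j)^\top\vec\xi(-j),\qquad A_N(e^{i\lambda})=\sum_{j\in Z^S\cap\{0,\dots,N\}}\vec a(j)e^{-ij\lambda},$$ and its mean-square optimal linear estimate $\hat A_N\vec\xi$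 from the observations $\vec\xi(j)+\vec\eta(j)$, $j\in\mathbb Z_-\setminus S$. Let $\mathbf a_N$ be the vector with components $\vec a(j)$ for $j\in Z^S\cap\{0,\dots,N\}$ and $\vec 0$ otherwise. Put $$B(k,j)=\tfrac1{2\pi}\!\int_{-\pi}^{\pi}(F+G)^{-1}e^{-i(k-j)\lambda}d\lambda,\quad R(k,j)=\tfrac1{2\pi}\!\int_{-\pi}^{\pi}F(F+G)^{-1}e^{-i(k+j)\lambda}d\lambda,\quad Q(k,j)=\tfrac1{2\pi}\!\int_{-\pi}^{\pi}F(F+G)^{-1}G\,e^{-i(k-j)\lambda}d\lambda ,$$ $(\mathbf R x)(k)^\top=\sum_j x(j)^\top R(k,j)$, $(\mathbf B x)(k)^\top=\sum_{j\in U} x(j)^\top B(k,j)$ for $k\in U$, $\langle y,x\rangle=\sum_{k\in U} y(k)^\top\overline{x(k)}$ and $\langle\mathbf Q x,x\rangle=\sum_{k,j}x(k)^\top Q(k,j)\overline{x(j)}$. Here $\mathbf B$ and $\langle\cdot,\cdot\rangle$ are given by these sums on finitely supported $x$ and are extended by continuity to the completion of the space of finitely supported sequences on $U$ in the norm $\langle\mathbf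 Bx,x\rangle^{1/2}$. Then $\mathbf c=\mathbf B^{-1}\mathbf R\mathbf a_N$ and $\langle\mathbf R\mathbf a_N,\mathbf B^{-1}\mathbf R\mathbf a_N\rangle$ exist and are uniquely determined, the series $\sum_{k\in U}\mathbf c(k)e^{ik\lambda}$ is the Fourier series of an integrable function, which is denoted by the same symbol, the spectral characteristic of $\hat A_N\vec\xi$ is (uniquely, up to null sets) $$h_N(e^{i\lambda})^\top=A_N(e^{i\lambda})^\top F(\lambda)(F(\lambda)+G(\lambda))^{-1}-\Big(\sum_{k\in U}(\mathbf B^{-1}\mathbf R\mathbf a_N)(k)e^{ik\lambda}\Big)^{\!\top}(F(\lambda)+G(\lambda))^{-1},$$ and the mean-square error is $$\Delta(h_N;F,G)=E\big|A_N\vec\xi-\hat A_N\vec\xi\big|^2=\langle\mathbf R\mathbf a_N,\mathbf B^{-1}\mathbf R\mathbf a_N\rangle+\langle\mathbf Q\mathbf a_N,\mathbf a_N\rangle ,$$ where $\Delta(h;F,G)=\frac1{2\pi}\int_{-\pi}^{\pi}(A_N-h)^\top F\,\overline{(A_N-h)}\,d\lambda+\frac1{2\pi}\int_{-\pi}^{\pi}h^\top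 G\,\overline{h}\,d\lambda$. If, moreover, the matrix of $\mathbf B$ defines a bounded operator of $\ell_2(U;\mathbb C^T)$ with a bounded inverse, then $\mathbf R\mathbf a_N\in\ell_2$ and $\mathbf B^{-1}\mathbf R\mathbf a_N$ and $\langle\mathbf R\mathbf a_N,\mathbf B^{-1}\mathbf R\mathbf a_N\rangle$ are given by this inverse and the inner product of $\ell_2$. -/

import Mathlib

open MeasureTheory Filter Topology Matrix
open scoped ENNReal ComplexConjugate ComplexOrder

noncomputable section

namespace Filtering

/-! ### Index sets -/

/-- `S`, the union of the blocks `{-(M l + L l), …, -M l}` of missing observations. -/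
def missing {s : ℕ} (M L : Fin s → ℕ) : Set ℤ :=
  {j | ∃ l, -((M l : ℤ) + L l) ≤ j ∧ j ≤ -(M l : ℤ)}

/-- `S⁺`, the union of the blocks `{M l, …, M l + L l}`. -/
def missingPlus {s : ℕ} (M L : Fin s → ℕ) : Set ℤ :=
  {j | ∃ l, (M l : ℤ) ≤ j ∧ j ≤ (M l : ℤ) + L l}

/-- `Z^S = {1, 2, …} \ S⁺`. -/
def posIdx {s : ℕ} (M L : Fin s → ℕ) : Set ℤ := {j | 1 ≤ j} \ missingPlus M L

/-- `Z₋ \ S`, the times at which `ξ + η` is observed. -/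
def obsIdx {s : ℕ} (M L : Fin s → ℕ) : Set ℤ := {j | j < 0} \ missing M L

/-- `U = S ∪ {0, 1, 2, …}`. -/
def unobsIdx {s : ℕ} (M L : Fin s → ℕ) : Set ℤ := missing M L ∪ {j | 0 ≤ j}

open Classical in
/-- `Z^S ∩ {0, …, N}`. -/
def truncIdx {s : ℕ} (M L : Fin s → ℕ) (N : ℕ) : Finset ℤ :=
  (Finset.Icc (0 : ℤ) N).filter (· ∈ posIdx M L)

open Classical in
/-- The truncated coefficient vector `a_N`: it is `a j` for `j ∈ Z^S ∩ {0, …, N}`, else `0`. -/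
def truncVec {T s : ℕ} (M L : Fin s → ℕ) (N : ℕ) (a : ℤ → Fin T → ℂ) : ℤ →₀ (Fin T → ℂ) :=
  Finsupp.onFinset (Finset.Icc (0 : ℤ) N) (fun j => if j ∈ truncIdx M L N then a j else 0)
    (by
      intro j hj
      by_contra h
      exact hj (if_neg fun h' => h (Finset.mem_filter.mp h').1))

/-! ### Functions on `(-π, π]` and Fourier coefficients -/

/-- Lebesgue measure on `(-π, π]`. -/
def circ : Measure ℝ := volume.restrict (Set.Ioc (-Real.pi) Real.pi)

/-- The exponential `e^{i n t}`. -/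
def ex (n : ℤ) (t : ℝ) : ℂ := Complex.exp (((n : ℝ) * t : ℝ) * Complex.I)

/-- `(2π)⁻¹ ∫_{-π}^{π} f(t) dt`. -/
def mean (f : ℝ → ℂ) : ℂ := (2 * (Real.pi : ℂ))⁻¹ * ∫ t, f t ∂circ

/-- The Fourier coefficient `(2π)⁻¹ ∫ f(t) e^{-i n t} dt`. -/
def fourierCo (f : ℝ → ℂ) (n : ℤ) : ℂ := mean fun t => f t * ex (-n) t

/-- Entrywise Fourier coefficients of a matrix-valued function. -/
def fourierCoM {T : ℕ} (Φ : ℝ → Matrix (Fin T) (Fin T) ℂ) (n : ℤ) : Matrix (Fin T) (Fin T) ℂ :=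
  Matrix.of fun p q => fourierCo (fun t => Φ t p q) n

/-- The trigonometric polynomial `∑_j p(j) e^{i j t}`. -/
def trigPoly {T : ℕ} (p : ℤ →₀ (Fin T → ℂ)) (t : ℝ) : Fin T → ℂ :=
  p.sum fun j v => ex j t • v

/-- The squared norm `∫ f(t)ᵀ V(t) \overline{f(t)} dt` of `L₂(V)`, for a matrix weight `V ≥ 0`. -/
def weightedSq {T : ℕ} (V : ℝ → Matrix (Fin T) (Fin T) ℂ) (f : ℝ → Fin T → ℂ) : ℝ≥0∞ :=
  ∫⁻ t, ENNReal.ofReal (f t ⬝ᵥ (V t *ᵥ star (f t))).re ∂circ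

/-- `f` lies in the closed linear span of `{e^{i n t} δ_k : n ∈ I, k}` in `L₂(V)`. -/
def InClosedSpan {T : ℕ} (V : ℝ → Matrix (Fin T) (Fin T) ℂ) (I : Set ℤ) (f : ℝ → Fin T → ℂ) :
    Prop :=
  AEMeasurable f circ ∧ ∀ ε : ℝ≥0∞, 0 < ε →
    ∃ p : ℤ →₀ (Fin T → ℂ), (p.support : Set ℤ) ⊆ I ∧ weightedSq V (f - trigPoly p) < ε

/-- `C` is the sum of the trigonometric series `∑_k c(k) e^{i k t}`: it is the integrable function
whose Fourier coefficients are the `c(k)`, `k ∈ ℤ`. -/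
def IsFourierSum {T : ℕ} (C : ℝ → Fin T → ℂ) (c : ℤ → Fin T → ℂ) : Prop :=
  ∀ l, Integrable (fun t => C t l) circ ∧ ∀ k, fourierCo (fun t => C t l) k = c k l

/-! ### Spectral densities and stationary sequences -/

/-- A spectral density: integrable on `(-π, π]`, with positive semidefinite Hermitian values. -/
structure IsSpectralDensity {T : ℕ} (F : ℝ → Matrix (Fin T) (Fin T) ℂ) : Prop where
  integrable : ∀ p q, Integrable (fun t => F t p q) circ
  posSemidef : ∀ᵐ t ∂circ, (F t).PosSemidef

/-- The minimality condition: `F + G` is invertible almost everywhere and its inverse is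
integrable. -/
def Minimality {T : ℕ} (F G : ℝ → Matrix (Fin T) (Fin T) ℂ) : Prop :=
  (∀ᵐ t ∂circ, IsUnit (F t + G t)) ∧ ∀ p q, Integrable (fun t => (F t + G t)⁻¹ p q) circ

/-- A (zero mean, second order) stationary sequence with spectral density `F`. -/
structure IsStationary {T : ℕ} {Ω : Type*} [MeasurableSpace Ω] (P : Measure Ω)
    (ξ : ℤ → Fin T → Lp ℂ 2 P) (F : ℝ → Matrix (Fin T) (Fin T) ℂ) : Prop where
  density : IsSpectralDensity F
  mean_zero : ∀ j p, ∫ ω, ξ j p ω ∂P = 0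
  covariance : ∀ n j p q,
    ∫ ω, ξ (j + n) p ω * conj (ξ j q ω) ∂P = mean fun t => ex n t * F t p q

/-- The (zero mean) sequences `ξ` and `η` are uncorrelated. -/
def Uncorrelated {T : ℕ} {Ω : Type*} [MeasurableSpace Ω] {P : Measure Ω}
    (ξ η : ℤ → Fin T → Lp ℂ 2 P) : Prop :=
  ∀ i j p q, ∫ ω, ξ i p ω * conj (η j q ω) ∂P = 0

/-! ### Linear estimates -/

/-- The closed linear span of `{ζ_k(j) : j ∈ I, k}` in `L₂(Ω, P)`. -/
def obsSpace {T : ℕ} {Ω : Type*} [MeasurableSpace Ω] {P : Measure Ω}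
    (ζ : ℤ → Fin T → Lp ℂ 2 P) (I : Set ℤ) : Submodule ℂ (Lp ℂ 2 P) :=
  (Submodule.span ℂ {x | ∃ j ∈ I, ∃ k, x = ζ j k}).topologicalClosure

/-- `Y` is a mean-square optimal linear estimate of `X` from `ζ(j)`, `j ∈ I`. -/
def IsOptimalEstimate {T : ℕ} {Ω : Type*} [MeasurableSpace Ω] {P : Measure Ω}
    (ζ : ℤ → Fin T → Lp ℂ 2 P) (I : Set ℤ) (X Y : Lp ℂ 2 P) : Prop :=
  Y ∈ obsSpace ζ I ∧ ∀ Z ∈ obsSpace ζ I, ‖X - Y‖ ≤ ‖X - Z‖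

/-- `Y = ∫ f(t)ᵀ Z_ζ(dt)`, where `ζ(j) = ∫ e^{i j t} Z_ζ(dt)` is the spectral decomposition of the
stationary sequence `ζ` with spectral density `V`. The stochastic integral is the isometric (up to
the factor `2π`) extension to `L₂(V)` of the map
`∑_j p(j) e^{i j t} ↦ ∑_j p(j)ᵀ ζ(j)`. -/
def IsSpectralIntegral {T : ℕ} {Ω : Type*} [MeasurableSpace Ω] {P : Measure Ω}
    (V : ℝ → Matrix (Fin T) (Fin T) ℂ) (ζ : ℤ → Fin T → Lp ℂ 2 P) (f : ℝ → Fin T → ℂ)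
    (Y : Lp ℂ 2 P) : Prop :=
  AEMeasurable f circ ∧ ∀ ε : ℝ, 0 < ε → ∃ p : ℤ →₀ (Fin T → ℂ),
    weightedSq V (f - trigPoly p) < ENNReal.ofReal ε ∧
      ‖Y - p.sum fun j v => ∑ k, v k • ζ j k‖ < ε

/-- `f` is the spectral characteristic of the linear estimate `Y` from `ζ(j)`, `j ∈ I`:
`f` lies in the closed span of `e^{i j t} δ_k`, `j ∈ I`, in `L₂(V)` and `Y = ∫ f(t)ᵀ Z_ζ(dt)`. -/
def IsSpectralChar {T : ℕ} {Ω : Type*} [MeasurableSpace Ω] {P : Measure Ω}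
    (V : ℝ → Matrix (Fin T) (Fin T) ℂ) (ζ : ℤ → Fin T → Lp ℂ 2 P) (I : Set ℤ)
    (f : ℝ → Fin T → ℂ) (Y : Lp ℂ 2 P) : Prop :=
  InClosedSpan V I f ∧ IsSpectralIntegral V ζ f Y

/-- The functional `A_N ξ = ∑_{j ∈ Z^S ∩ {0..N}} a(j)ᵀ ξ(-j)`. -/
def functional {T s : ℕ} {Ω : Type*} [MeasurableSpace Ω] {P : Measure Ω} (M L : Fin s → ℕ) (N : ℕ)
    (a : ℤ → Fin T → ℂ) (ξ : ℤ → Fin T → Lp ℂ 2 P) : Lp ℂ 2 P :=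
  ∑ j ∈ truncIdx M L N, ∑ k, a j k • ξ (-j) k

/-- `A_N(e^{i t}) = ∑_{j ∈ Z^S ∩ {0..N}} a(j) e^{-i j t}`. -/
def symbolA {T s : ℕ} (M L : Fin s → ℕ) (N : ℕ) (a : ℤ → Fin T → ℂ) (t : ℝ) : Fin T → ℂ :=
  ∑ j ∈ truncIdx M L N, ex (-j) t • a j

/-- The mean-square error `Δ(h; F, G)` of the estimate with spectral characteristic `h`, for the
functional with symbol `A`. -/
def mse {T : ℕ} (F G : ℝ → Matrix (Fin T) (Fin T) ℂ) (A h : ℝ → Fin T → ℂ) : ℂ :=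
  mean (fun t => (A t - h t) ⬝ᵥ (F t *ᵥ star (A t - h t))) +
    mean (fun t => h t ⬝ᵥ (G t *ᵥ star (h t)))

/-! ### The operators `B`, `R`, `Q` -/

/-- The blocks `B(k,j) = (2π)⁻¹ ∫ (F+G)⁻¹ e^{-i(k-j)t} dt`. -/
def blockB {T : ℕ} (F G : ℝ → Matrix (Fin T) (Fin T) ℂ) (k j : ℤ) : Matrix (Fin T) (Fin T) ℂ :=
  fourierCoM (fun t => (F t + G t)⁻¹) (k - j)

/-- The blocks `R(k,j) = (2π)⁻¹ ∫ F (F+G)⁻¹ e^{-i(k+j)t} dt`. -/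
def blockR {T : ℕ} (F G : ℝ → Matrix (Fin T) (Fin T) ℂ) (k j : ℤ) : Matrix (Fin T) (Fin T) ℂ :=
  fourierCoM (fun t => F t * (F t + G t)⁻¹) (k + j)

/-- The blocks `Q(k,j) = (2π)⁻¹ ∫ F (F+G)⁻¹ G e^{-i(k-j)t} dt`. -/
def blockQ {T : ℕ} (F G : ℝ → Matrix (Fin T) (Fin T) ℂ) (k j : ℤ) : Matrix (Fin T) (Fin T) ℂ :=
  fourierCoM (fun t => F t * (F t + G t)⁻¹ * G t) (k - j)

/-- The action of a block matrix `X` on finitely supported vectors, the vectors being written as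
rows: `(X x)(k)ᵀ = ∑_j x(j)ᵀ X(k,j)`. -/
def blockApply {T : ℕ} (X : ℤ → ℤ → Matrix (Fin T) (Fin T) ℂ) (x : ℤ →₀ (Fin T → ℂ)) (k : ℤ) :
    Fin T → ℂ :=
  x.sum fun j v => v ᵥ* X k j

/-- `⟨y, x⟩ = ∑_k y(k)ᵀ \overline{x(k)}`, for a finitely supported `x`. -/
def pairing {T : ℕ} (y : ℤ → Fin T → ℂ) (x : ℤ →₀ (Fin T → ℂ)) : ℂ :=
  x.sum fun k v => y k ⬝ᵥ star v

/-- `⟨Q a, a⟩ = ∑_{k,j} a(k)ᵀ Q(k,j) \overline{a(j)}`. -/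
def quadForm {T : ℕ} (X : ℤ → ℤ → Matrix (Fin T) (Fin T) ℂ) (a : ℤ →₀ (Fin T → ℂ)) : ℂ :=
  a.sum fun k v => a.sum fun j w => v ⬝ᵥ (X k j *ᵥ star w)

/-- `c = B⁻¹ y` and `r = ⟨y, B⁻¹ y⟩`, for the operator `B` which the positive semidefinite block
matrix `X(k,j)`, `k, j ∈ U`, defines on sequences indexed by `U` (written as sequences on `ℤ` that
vanish off `U`). The operator is given by the matrix on finitely supported sequences and is
extended to the completion of these in the norm `⟨B x, x⟩^{1/2}`: there are finitely supported
`x_n` that form a Cauchy sequence for this norm, such that coordinatewise `x_n → c` and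
`B x_n → y`; and `⟨y, c⟩` is the limit of `⟨y, x_n⟩`. -/
def IsInverseImage {T : ℕ} (X : ℤ → ℤ → Matrix (Fin T) (Fin T) ℂ) (U : Set ℤ)
    (y c : ℤ → Fin T → ℂ) (r : ℂ) : Prop :=
  (∀ k ∉ U, c k = 0) ∧ ∃ x : ℕ → ℤ →₀ (Fin T → ℂ),
    (∀ n, ((x n).support : Set ℤ) ⊆ U) ∧
    (∀ ε : ℝ, 0 < ε → ∃ n₀, ∀ m ≥ n₀, ∀ n ≥ n₀,
      ‖pairing (blockApply X (x m - x n)) (x m - x n)‖ < ε) ∧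
    (∀ k, Tendsto (fun n => x n k) atTop (𝓝 (c k))) ∧
    (∀ k ∈ U, Tendsto (fun n => blockApply X (x n) k) atTop (𝓝 (y k))) ∧
    Tendsto (fun n => pairing y (x n)) atTop (𝓝 r)

/-- The Hilbert space `ℓ₂` of square summable sequences of vectors indexed by `U`. -/
abbrev SeqL2 (T : ℕ) (U : Set ℤ) : Type := lp (fun _ : U => EuclideanSpace ℂ (Fin T)) 2

open Classical in
/-- The bounded operator `E` on `ℓ₂` is given by the block matrix `X(k,j)`, `k, j ∈ U`. -/
def HasBlocks {T : ℕ} {U : Set ℤ} (X : ℤ → ℤ → Matrix (Fin T) (Fin T) ℂ)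
    (E : SeqL2 T U →L[ℂ] SeqL2 T U) : Prop :=
  ∀ (j k : U) (v : Fin T → ℂ),
    (E (lp.single 2 j (WithLp.toLp 2 v)) k).ofLp = v ᵥ* X k j

/-- The function `h` with `hᵀ = Aᵀ F (F+G)⁻¹ - Cᵀ (F+G)⁻¹`. -/
def specFormula {T : ℕ} (F G : ℝ → Matrix (Fin T) (Fin T) ℂ) (A C : ℝ → Fin T → ℂ) (t : ℝ) :
    Fin T → ℂ :=
  A t ᵥ* (F t * (F t + G t)⁻¹) - C t ᵥ* (F t + G t)⁻¹

end Filtering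

end

open Filtering

/-! The problem is moved into `L₂((-π, π]; ℂᵀ)`. Let `V = F + G`, `D = V^{1/2}`, and let `Di` be the
inverse of `D`. Let `α(j,q)` be `e^{ijt}` times row `q` of `D`, and `β(k,p)` be `e^{ikt}` times row
`p` of `Di`. The Gram matrix of `α` is the covariance of `ξ + η`, the Gram matrix of `β` is `B`, and
the two families are biorthogonal because `D Di = 1`. The vector `φ = A F Di` has the same inner
products with `α` as `A_N ξ` has with `ξ + η`. So the estimate corresponds to the projection `φ - ψ`
of `φ` onto the closed span of `α(j)`, `j ∉ U`.

The crux is that the residual `ψ`, orthogonal to these `α(j)`, lies in the closed span of `β(k)`, `k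
∈ U`. Biorthogonality alone does not give this. For `U = {0, 1, …}`: if `g ⊥ α(j)` for `j < 0` and
`f ⊥ β(k)` for `k ≥ 0`, then the entries of `gD` and of `conj (f Di)` are integrable with spectra in
`n ≥ 0` and `n > 0`, and `⟨f, g⟩` is the mean of `∑ (gD)_q conj (f Di)_q`. This sum is integrable
although its terms need not be, and a Smirnov type theorem (`integral_sum_mul_eq_zero_of_hardy`)
shows that its mean vanishes. The finitely many further indices of `S` cost only a finite correction
(`IsWeightRoot.inner_eq_zero`).

Since `⟨B x, x⟩ = ‖∑ x(k) β(k)‖²`, the energy completion is the closed span of the `β(k)`, `k ∈ U`,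
and `B⁻¹ R a_N` is represented there by `ψ` (`isInverseImage_of_biorthogonal`). Its coordinates
`⟨α(k,p), ψ⟩` are the Fourier coefficients of `C = ψ D`, and `r = ‖ψ‖²`. Multiplying `φ - ψ` by `Di`
gives the spectral characteristic. By Pythagoras the error is `‖A_N ξ‖² - ‖φ‖² + ‖ψ‖²`, and the
first two terms give the form of `F - F V⁻¹ F = F V⁻¹ G`, that is, `⟨Q a_N, a_N⟩`. -/

noncomputable section

namespace Filtering

/-! ### Measurable square roots of matrix weights -/

section SquareRoot
open scoped Matrix.Norms.L2Operator MatrixOrder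

/-- The positive square root is continuous on the closed cone of positive semidefinite matrices.
Extended by zero off the cone it is Borel, so composing it with the entries of `V` preserves
measurability. -/
theorem exists_measurable_sqrt {T : ℕ} {μ : Measure ℝ} {V : ℝ → Matrix (Fin T) (Fin T) ℂ}
    (hV : ∀ p q, AEMeasurable (fun t => V t p q) μ) (hpos : ∀ᵐ t ∂μ, (V t).PosSemidef) :
    ∃ D : ℝ → Matrix (Fin T) (Fin T) ℂ, (∀ p q, AEMeasurable (fun t => D t p q) μ) ∧
      ∀ᵐ t ∂μ, (D t).IsHermitian ∧ D t * D t = V t := by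
  have hmeas : AEMeasurable (fun t (i : Fin T × Fin T) => V t i.1 i.2) μ :=
    aemeasurable_pi_lambda _ fun i => hV i.1 i.2
  -- Measurability lives on the space of entries, continuity of the root on matrices with the
  -- operator norm; `toMat` links the two.
  let toMat : (Fin T × Fin T → ℂ) → Matrix (Fin T) (Fin T) ℂ := fun x => Matrix.of fun p q => x (p, q)
  have htoMat : Continuous toMat := by
    refine continuous_matrix fun p q => ?_
    exact continuous_apply _
  let s : Set (Fin T × Fin T → ℂ) := toMat ⁻¹' {a | 0 ≤ a}
  have hs : MeasurableSet s := (IsClosed.preimage htoMat isClosed_Ici).measurableSet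
  have hcont : ContinuousOn (fun x (i : Fin T × Fin T) => CFC.sqrt (toMat x) i.1 i.2) s := by
    refine continuousOn_pi.2 fun i => ?_
    have h1 : ContinuousOn (fun x => CFC.sqrt (toMat x)) s :=
      CFC.continuousOn_sqrt.comp htoMat.continuousOn fun x hx => hx
    exact (continuous_id.matrix_elem i.1 i.2).comp_continuousOn h1
  classical
  have hm : Measurable (s.piecewise (fun x (i : Fin T × Fin T) => CFC.sqrt (toMat x) i.1 i.2) 0) :=
    hcont.measurable_piecewise continuousOn_const hs
  refine ⟨fun t => Matrix.of fun p q => s.piecewise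
    (fun x (i : Fin T × Fin T) => CFC.sqrt (toMat x) i.1 i.2) 0 (fun i => V t i.1 i.2) (p, q),
    fun p q => ?_, ?_⟩
  · exact ((measurable_pi_apply _).comp hm).comp_aemeasurable hmeas
  · filter_upwards [hpos] with t ht
    have h0 : (0 : Matrix (Fin T) (Fin T) ℂ) ≤ V t := ht.nonneg
    have hmem : (fun i : Fin T × Fin T => V t i.1 i.2) ∈ s := h0
    have he : (Matrix.of fun p q => s.piecewise
        (fun x (i : Fin T × Fin T) => CFC.sqrt (toMat x) i.1 i.2) 0 (fun i => V t i.1 i.2) (p, q))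
        = CFC.sqrt (V t) := by
      rw [Set.piecewise_eq_of_mem _ _ _ hmem]
      rfl
    rw [he]
    exact ⟨(CFC.sqrt_nonneg (V t)).posSemidef.isHermitian, CFC.sqrt_mul_sqrt_self (V t) h0⟩

end SquareRoot

/-! ### Fejér means and their convergence in `L₁` of the circle -/

section Fejer
open AddCircle
variable {τ : ℝ}

/-- The Fejér kernel, as a function of two variables. -/
def fejerKernel (m : ℕ) (t s : AddCircle τ) : ℝ :=
  ((m : ℝ) + 1)⁻¹ * ‖∑ a ∈ Finset.range (m + 1), fourier (a : ℤ) t * fourier (-(a : ℤ)) s‖ ^ 2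

theorem fejerKernel_nonneg (m : ℕ) (t s : AddCircle τ) : 0 ≤ fejerKernel m t s := by
  unfold fejerKernel; positivity

/-- The squared modulus makes positivity evident; expanding it as a product with the conjugate
exhibits the Fourier series of the kernel. -/
theorem coe_fejerKernel (m : ℕ) (t s : AddCircle τ) :
    (fejerKernel m t s : ℂ) = ((m : ℂ) + 1)⁻¹ * ∑ a ∈ Finset.range (m + 1),
      ∑ b ∈ Finset.range (m + 1), fourier (-((a : ℤ) - b)) s * fourier ((a : ℤ) - b) t := by
  unfold fejerKernel
  push_cast
  rw [← Complex.mul_conj', map_sum, Finset.sum_mul_sum]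
  congr 1
  refine Finset.sum_congr rfl fun a _ => Finset.sum_congr rfl fun b _ => ?_
  rw [map_mul, ← fourier_neg, ← fourier_neg, neg_neg, sub_eq_add_neg, neg_add, neg_neg, fourier_add,
    fourier_add]
  ring

theorem continuous_fejerKernel (m : ℕ) :
    Continuous fun x : AddCircle τ × AddCircle τ => fejerKernel m x.1 x.2 := by
  unfold fejerKernel
  fun_prop

variable [hτ : Fact (0 < τ)]

/-- The Fejér means of the Fourier series of `f`. -/
def fejer (m : ℕ) (f : AddCircle τ → ℂ) (t : AddCircle τ) : ℂ :=
  ((m : ℂ) + 1)⁻¹ * ∑ a ∈ Finset.range (m + 1), ∑ b ∈ Finset.range (m + 1),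
    fourierCoeff f ((a : ℤ) - b) * fourier ((a : ℤ) - b) t

theorem integral_fourier (n : ℤ) :
    ∫ t : AddCircle τ, fourier n t ∂haarAddCircle = if n = 0 then 1 else 0 := by
  have h := congrFun (fourierCoeff_fourier (T := τ) n) 0
  simp only [fourierCoeff, neg_zero, fourier_zero, one_smul] at h
  rw [h, Pi.single_apply]
  simp [eq_comm]

theorem integrable_of_continuous {E : Type*} [NormedAddCommGroup E] {f : AddCircle τ → E}
    (hf : Continuous f) : Integrable f haarAddCircle :=
  hf.integrable_of_hasCompactSupport (HasCompactSupport.of_compactSpace f)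

/-- Only the `m + 1` diagonal terms `a = b` of the expansion have nonzero mean. -/
theorem integral_fejerKernel (m : ℕ) (s : AddCircle τ) :
    ∫ t, fejerKernel m t s ∂haarAddCircle = 1 := by
  have h : ((∫ t, fejerKernel m t s ∂haarAddCircle : ℝ) : ℂ) = 1 := by
    rw [← integral_complex_ofReal]
    simp_rw [coe_fejerKernel]
    rw [integral_const_mul, integral_finsetSum _ fun a _ => integrable_of_continuous (by fun_prop)]
    have : ∀ a ∈ Finset.range (m + 1), ∫ t : AddCircle τ, ∑ b ∈ Finset.range (m + 1),
        fourier (-((a : ℤ) - b)) s * fourier ((a : ℤ) - b) t ∂haarAddCircle = 1 := by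
      intro a ha
      rw [integral_finsetSum _ fun a _ => integrable_of_continuous (by fun_prop)]
      simp_rw [integral_const_mul, integral_fourier]
      rw [Finset.sum_eq_single a]
      · simp
      · intro b _ hb
        rw [if_neg (by omega), mul_zero]
      · exact fun h => (h ha).elim
    rw [Finset.sum_congr rfl this]
    simp
    have : (m : ℂ) + 1 ≠ 0 := by exact_mod_cast m.succ_ne_zero
    field_simp
  exact_mod_cast h

theorem fejer_eq_integral (m : ℕ) {f : AddCircle τ → ℂ} (hf : Integrable f haarAddCircle)
    (t : AddCircle τ) :
    fejer m f t = ∫ s, (fejerKernel m t s : ℂ) * f s ∂haarAddCircle := by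
  have hi : ∀ n : ℤ, Integrable (fun s => fourier n s * f s) haarAddCircle := fun n => by
    simpa using hf.fourier_smul n
  simp_rw [coe_fejerKernel, mul_assoc, integral_const_mul, Finset.sum_mul]
  unfold fejer
  congr 1
  have hi' : ∀ n k : ℤ, Integrable (fun s => fourier n s * fourier k t * f s) haarAddCircle :=
    fun n k => ((hi n).const_mul (fourier k t)).congr (Eventually.of_forall fun s => by
      simp only; ring)
  rw [integral_finsetSum _ fun a _ => integrable_finsetSum _ fun b _ => hi' _ _]
  refine Finset.sum_congr rfl fun a _ => ?_
  rw [integral_finsetSum _ fun b _ => hi' _ _]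
  refine Finset.sum_congr rfl fun b _ => ?_
  rw [fourierCoeff, ← integral_mul_const]
  refine integral_congr_ae (Eventually.of_forall fun s => ?_)
  simp only [smul_eq_mul]; ring

theorem continuous_fejer (m : ℕ) (f : AddCircle τ → ℂ) : Continuous (fejer m f) := by
  unfold fejer
  fun_prop

/-- A Fejér mean is an average against a positive kernel. This is why Fejér means, and not partial
sums, are used for exponentials of Hardy functions. -/
theorem fejer_re_nonneg (m : ℕ) {f : AddCircle τ → ℂ} (hf : Integrable f haarAddCircle)
    (h0 : ∀ᵐ s ∂haarAddCircle, 0 ≤ (f s).re) (t : AddCircle τ) : 0 ≤ (fejer m f t).re := by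
  have hk : Continuous fun s : AddCircle τ => fejerKernel m t s := by
    unfold fejerKernel
    fun_prop
  have hi : Integrable (fun s => (fejerKernel m t s : ℂ) * f s) haarAddCircle := by
    have hb : ∃ c : ℝ, ∀ s, ‖fejerKernel m t s‖ ≤ c := by
      obtain ⟨c, hc⟩ := (isCompact_range hk).isBounded.exists_norm_le
      exact ⟨c, fun s => hc _ (Set.mem_range_self s)⟩
    obtain ⟨c, hc⟩ := hb
    have hc' : ∀ s, ‖(fejerKernel m t s : ℂ)‖ ≤ c := fun s => by
      rw [Complex.norm_real]
      exact hc s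
    have hm : AEStronglyMeasurable (fun s => (fejerKernel m t s : ℂ)) haarAddCircle :=
      (Complex.continuous_ofReal.comp hk).aestronglyMeasurable
    exact hf.bdd_mul hm (Eventually.of_forall hc')
  rw [fejer_eq_integral m hf, ← RCLike.re_eq_complex_re, ← integral_re hi]
  refine integral_nonneg_of_ae ?_
  filter_upwards [h0] with s hs
  simpa using mul_nonneg (fejerKernel_nonneg m t s) hs

/-- By Fubini, since the kernel is nonnegative and has mean one in `t`. -/
theorem integral_norm_fejer_le (m : ℕ) {f : AddCircle τ → ℂ} (hf : Integrable f haarAddCircle) :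
    ∫ t, ‖fejer m f t‖ ∂haarAddCircle ≤ ∫ t, ‖f t‖ ∂haarAddCircle := by
  have hK := continuous_fejerKernel (τ := τ) m
  have hi : Integrable (fun x : AddCircle τ × AddCircle τ => fejerKernel m x.1 x.2 * ‖f x.2‖)
      (haarAddCircle.prod haarAddCircle) := by
    obtain ⟨c, hc⟩ := (isCompact_univ.image hK).isBounded.exists_norm_le
    exact (hf.norm.comp_snd haarAddCircle).bdd_mul (c := c) hK.aestronglyMeasurable
      (Eventually.of_forall fun s => hc _ ⟨s, trivial, rfl⟩)
  calc ∫ t, ‖fejer m f t‖ ∂haarAddCircle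
      ≤ ∫ t, ∫ s, fejerKernel m t s * ‖f s‖ ∂haarAddCircle ∂haarAddCircle := by
        refine integral_mono (integrable_of_continuous (continuous_fejer m f).norm)
          hi.integral_prod_left fun t => ?_
        rw [fejer_eq_integral m hf]
        refine (norm_integral_le_integral_norm _).trans_eq ?_
        simp [abs_of_nonneg (fejerKernel_nonneg m t _)]
    _ = ∫ s, ∫ t, fejerKernel m t s * ‖f s‖ ∂haarAddCircle ∂haarAddCircle :=
        integral_integral_swap hi
    _ = ∫ t, ‖f t‖ ∂haarAddCircle := by
        simp_rw [integral_mul_const, integral_fejerKernel, one_mul]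

theorem fejer_congr (m : ℕ) {f g : AddCircle τ → ℂ} (h : f =ᵐ[haarAddCircle] g) :
    fejer m f = fejer m g := by
  unfold fejer
  rw [fourierCoeff_congr_ae h]

theorem fejer_add (m : ℕ) {f g : AddCircle τ → ℂ} (hf : Integrable f haarAddCircle)
    (hg : Integrable g haarAddCircle) : fejer m (f + g) = fejer m f + fejer m g := by
  funext t
  simp only [fejer, fourierCoeff.add hf hg, Pi.add_apply, ← mul_add, ← Finset.sum_add_distrib,
    add_mul]

theorem fejer_smul (m : ℕ) (c : ℂ) (f : AddCircle τ → ℂ) : fejer m (c • f) = c • fejer m f := by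
  funext t
  have h : ∀ n, fourierCoeff (c • f) n = c * fourierCoeff f n := fun n => by
    exact fourierCoeff.const_mul f c n
  simp only [fejer, h, Pi.smul_apply, smul_eq_mul, Finset.mul_sum]
  refine Finset.sum_congr rfl fun a _ => Finset.sum_congr rfl fun b _ => ?_
  ring

theorem card_filter_sub_eq (m : ℕ) (j : ℤ) :
    ∑ a ∈ Finset.range (m + 1), ∑ b ∈ Finset.range (m + 1), (if (a : ℤ) - b = j then (1 : ℂ) else 0)
      = ((Finset.range (m + 1)).filter fun a : ℕ => 0 ≤ (a : ℤ) - j ∧ (a : ℤ) - j ≤ m).card := by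
  rw [Finset.card_filter]
  push_cast
  refine Finset.sum_congr rfl fun a _ => ?_
  split_ifs with h
  · rw [Finset.sum_eq_single ((a : ℤ) - j).toNat]
    · rw [if_pos (by omega)]
    · intro b _ hb
      rw [if_neg (by omega)]
    · intro hb
      simp only [Finset.mem_range] at hb
      omega
  · refine Finset.sum_eq_zero fun b hb => if_neg ?_
    simp only [Finset.mem_range] at hb
    omega

/-- The factor by which a Fejér mean multiplies frequency `j`. The squeeze needs only the crude
lower bound `m + 1 - 2|j|` for the number of pairs. -/
theorem tendsto_fejer_weight (j : ℤ) :
    Tendsto (fun m : ℕ => ((m : ℂ) + 1)⁻¹ * ∑ a ∈ Finset.range (m + 1),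
      ∑ b ∈ Finset.range (m + 1), (if (a : ℤ) - b = j then (1 : ℂ) else 0)) atTop (𝓝 1) := by
  simp_rw [card_filter_sub_eq]
  have key : Tendsto (fun m : ℕ => ((m : ℝ) + 1)⁻¹ * (((Finset.range (m + 1)).filter
      fun a : ℕ => 0 ≤ (a : ℤ) - j ∧ (a : ℤ) - j ≤ m).card : ℝ)) atTop (𝓝 1) := by
    have hlow : Tendsto (fun m : ℕ => 1 - (2 * j.natAbs : ℝ) * (1 / ((m : ℝ) + 1))) atTop (𝓝 1) := by
      simpa using (tendsto_one_div_add_atTop_nhds_zero_nat (𝕜 := ℝ)).const_mul (2 * j.natAbs : ℝ)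
        |>.const_sub 1
    refine tendsto_of_tendsto_of_tendsto_of_le_of_le hlow tendsto_const_nhds (fun m => ?_)
      fun m => ?_
    · have hpos : (0 : ℝ) < m + 1 := by positivity
      have hc : m + 1 ≤ ((Finset.range (m + 1)).filter
          fun a : ℕ => 0 ≤ (a : ℤ) - j ∧ (a : ℤ) - j ≤ m).card + 2 * j.natAbs := by
        -- An `a` whose partner `a - j` leaves the range is among the `|j|` smallest or the `|j|`
        -- largest.
        have hsub : Finset.range (m + 1) ⊆ ((Finset.range (m + 1)).filter
            fun a : ℕ => 0 ≤ (a : ℤ) - j ∧ (a : ℤ) - j ≤ m) ∪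
            (Finset.range j.natAbs ∪ Finset.Ico (m + 1 - j.natAbs) (m + 1)) := by
          intro a ha
          simp only [Finset.mem_union, Finset.mem_filter, Finset.mem_range, Finset.mem_Ico] at ha ⊢
          omega
        have h1 := (Finset.card_le_card hsub).trans (Finset.card_union_le _ _)
        have h2 := Finset.card_union_le (Finset.range j.natAbs)
          (Finset.Ico (m + 1 - j.natAbs) (m + 1))
        simp only [Finset.card_range, Nat.card_Ico] at h1 h2
        omega
      have hc' : (m : ℝ) + 1 ≤ (((Finset.range (m + 1)).filter
          fun a : ℕ => 0 ≤ (a : ℤ) - j ∧ (a : ℤ) - j ≤ m).card : ℝ) + 2 * j.natAbs := by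
        exact_mod_cast hc
      have : 1 - (2 * j.natAbs : ℝ) * (1 / ((m : ℝ) + 1)) =
          ((m : ℝ) + 1)⁻¹ * ((m : ℝ) + 1 - 2 * j.natAbs) := by field_simp
      rw [this]
      gcongr
      linarith
    · have hpos : (0 : ℝ) < m + 1 := by positivity
      have hc := Finset.card_filter_le (Finset.range (m + 1))
        fun a : ℕ => 0 ≤ (a : ℤ) - j ∧ (a : ℤ) - j ≤ m
      rw [Finset.card_range] at hc
      have hc' : (((Finset.range (m + 1)).filter
          fun a : ℕ => 0 ≤ (a : ℤ) - j ∧ (a : ℤ) - j ≤ m).card : ℝ) ≤ m + 1 := by exact_mod_cast hc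
      simp only
      rw [inv_mul_le_iff₀ hpos]
      linarith
  have := (Complex.continuous_ofReal.tendsto 1).comp key
  refine (this.congr fun m => ?_)
  simp

theorem fejer_fourier (m : ℕ) (j : ℤ) (t : AddCircle τ) :
    fejer m (fourier j) t = (((m : ℂ) + 1)⁻¹ * ∑ a ∈ Finset.range (m + 1),
      ∑ b ∈ Finset.range (m + 1), (if (a : ℤ) - b = j then (1 : ℂ) else 0)) * fourier j t := by
  unfold fejer
  rw [mul_assoc, Finset.sum_mul]
  congr 1
  refine Finset.sum_congr rfl fun a _ => ?_
  rw [Finset.sum_mul]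
  refine Finset.sum_congr rfl fun b _ => ?_
  rw [fourierCoeff_fourier, Pi.single_apply]
  split_ifs with h
  · rw [h]
  · simp

theorem integrable_fejer_sub (m : ℕ) {f : AddCircle τ → ℂ} (hf : Integrable f haarAddCircle) :
    Integrable (fun t => fejer m f t - f t) haarAddCircle :=
  (integrable_of_continuous (continuous_fejer m f)).sub hf

/-- Fejér's theorem in `L₁`. -/
theorem tendsto_fejer {f : AddCircle τ → ℂ} (hf : Integrable f haarAddCircle) :
    Tendsto (fun m => ∫ t, ‖fejer m f t - f t‖ ∂haarAddCircle) atTop (𝓝 0) := by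
  -- Convergence is explicit on trigonometric polynomials; their density in `L₁` and the contraction
  -- property of Fejér means give the rest.
  have hspan : ∀ g : Lp ℂ 1 (haarAddCircle (T := τ)),
      g ∈ Submodule.span ℂ (Set.range (@fourierLp τ _ 1 _)) →
      Tendsto (fun m => ∫ t, ‖fejer m g t - g t‖ ∂haarAddCircle) atTop (𝓝 0) := by
    intro g hg
    induction hg using Submodule.span_induction with
    | mem x hx =>
      obtain ⟨j, rfl⟩ := hx
      have h := (tendsto_fejer_weight j).sub_const 1 |>.norm
      rw [sub_self, norm_zero] at h
      refine h.congr fun m => ?_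
      have hae := coeFn_fourierLp (T := τ) 1 j
      have : ∀ᵐ t : AddCircle τ ∂haarAddCircle,
          ‖fejer m (fourierLp 1 j) t - (fourierLp 1 j) t‖ = ‖((m : ℂ) + 1)⁻¹ *
            ∑ a ∈ Finset.range (m + 1), ∑ b ∈ Finset.range (m + 1),
              (if (a : ℤ) - b = j then (1 : ℂ) else 0) - 1‖ := by
        filter_upwards [hae] with t ht
        rw [fejer_congr m hae, ht, fejer_fourier]
        rw [← sub_one_mul, norm_mul]
        have : ‖fourier j t‖ = 1 := by
          rw [fourier_apply]; exact Circle.norm_coe _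
        rw [this, mul_one]
      rw [integral_congr_ae this]
      simp
    | zero =>
      have hae := Lp.coeFn_zero ℂ 1 (haarAddCircle (T := τ))
      refine tendsto_const_nhds.congr fun m => ?_
      symm
      have : ∀ᵐ t : AddCircle τ ∂haarAddCircle,
          ‖fejer m (0 : Lp ℂ 1 (haarAddCircle (T := τ))) t
            - (0 : Lp ℂ 1 (haarAddCircle (T := τ))) t‖ = 0 := by
        filter_upwards [hae] with t ht
        rw [fejer_congr m hae, ht]
        simp [fejer, fourierCoeff]
      rw [integral_congr_ae this]
      simp
    | add x y _ _ hx hy =>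
      have hxy := hx.add hy
      rw [add_zero] at hxy
      have ix := L1.integrable_coeFn x
      have iy := L1.integrable_coeFn y
      refine tendsto_of_tendsto_of_tendsto_of_le_of_le tendsto_const_nhds hxy
        (fun m => integral_nonneg fun _ => norm_nonneg _) fun m => ?_
      simp only
      rw [← integral_add (integrable_fejer_sub m ix).norm (integrable_fejer_sub m iy).norm]
      refine integral_mono_ae ?_ ((integrable_fejer_sub m ix).norm.add
        (integrable_fejer_sub m iy).norm) ?_
      · exact (integrable_fejer_sub m (L1.integrable_coeFn (x + y))).norm
      · filter_upwards [Lp.coeFn_add x y] with t ht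
        rw [fejer_congr m (Lp.coeFn_add x y), ht, fejer_add m ix iy]
        simp only [Pi.add_apply]
        rw [add_sub_add_comm]
        exact norm_add_le _ _
    | smul c x _ hx =>
      have h := hx.const_mul ‖c‖
      rw [mul_zero] at h
      refine h.congr fun m => ?_
      rw [← integral_const_mul]
      refine integral_congr_ae ?_
      filter_upwards [Lp.coeFn_smul c x] with t ht
      rw [fejer_congr m (Lp.coeFn_smul c x), ht, fejer_smul]
      simp [← mul_sub]
  rw [Metric.tendsto_atTop]
  intro ε hε
  have hd : (hf.toL1 f) ∈ closure (Submodule.span ℂ (Set.range (@fourierLp τ _ 1 _)) : Set _) := by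
    rw [← Submodule.topologicalClosure_coe, span_fourierLp_closure_eq_top ENNReal.one_ne_top]
    trivial
  obtain ⟨g, hg, hfg⟩ := Metric.mem_closure_iff.1 hd (ε / 3) (by positivity)
  have ig := L1.integrable_coeFn g
  have hdist : ∫ t, ‖f t - g t‖ ∂haarAddCircle < ε / 3 := by
    rw [L1.dist_eq_integral_dist] at hfg
    refine lt_of_eq_of_lt (integral_congr_ae ?_) hfg
    filter_upwards [hf.coeFn_toL1] with t ht
    rw [ht, dist_eq_norm]
  obtain ⟨m₀, hm₀⟩ := Metric.tendsto_atTop.1 (hspan g hg) (ε / 3) (by positivity)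
  refine ⟨m₀, fun m hm => ?_⟩
  have h1 := hm₀ m hm
  rw [Real.dist_0_eq_abs, abs_of_nonneg (integral_nonneg fun _ => norm_nonneg _)] at h1 ⊢
  have h2 := integral_norm_fejer_le m (hf.sub ig)
  have hadd := fejer_add m (hf.sub ig) ig
  rw [sub_add_cancel] at hadd
  have i1 := integrable_of_continuous (continuous_fejer m (f - ⇑g))
  have i2 := integrable_fejer_sub m ig
  have i3 := hf.sub ig
  calc ∫ t, ‖fejer m f t - f t‖ ∂haarAddCircle
      ≤ ∫ t, (‖fejer m (f - ⇑g) t‖ + ‖fejer m g t - g t‖) + ‖(f - ⇑g) t‖ ∂haarAddCircle := by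
        refine integral_mono (integrable_fejer_sub m hf).norm ((i1.norm.add i2.norm).add i3.norm)
          fun t => ?_
        simp only
        rw [hadd]
        calc ‖(fejer m (f - ⇑g) + fejer m g) t - f t‖
            = ‖fejer m (f - ⇑g) t + (fejer m g t - g t) - (f - ⇑g) t‖ := by
              congr 1; simp only [Pi.add_apply, Pi.sub_apply]; ring
          _ ≤ _ := (norm_sub_le _ _).trans (by gcongr; exact norm_add_le _ _)
    _ = ∫ t, ‖fejer m (f - ⇑g) t‖ ∂haarAddCircle + ∫ t, ‖fejer m g t - g t‖ ∂haarAddCircle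
        + ∫ t, ‖(f - ⇑g) t‖ ∂haarAddCircle := by
        have e1 := integral_add (i1.norm.add i2.norm) i3.norm
        have e2 := integral_add i1.norm i2.norm
        simp only [Pi.add_apply] at e1 e2
        rw [e1, e2]
    _ < ε := by
        simp only [Pi.sub_apply] at h2 ⊢
        linarith

end Fejer

/-! ### Hardy functions on the circle and a Smirnov type theorem -/

section Hardy
open AddCircle
variable {τ : ℝ} [hτ : Fact (0 < τ)]

/-- All Fejér means vanish, hence so does their `L₁` limit. -/
theorem ae_eq_zero_of_fourierCoeff_eq_zero {f : AddCircle τ → ℂ} (hf : Integrable f haarAddCircle)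
    (h : ∀ n, fourierCoeff f n = 0) : f =ᵐ[haarAddCircle] 0 := by
  have h0 : ∀ m t, fejer m f t = 0 := fun m t => by simp [fejer, h]
  have ht := tendsto_fejer hf
  simp only [h0, zero_sub, norm_neg] at ht
  have := (tendsto_nhds_unique ht tendsto_const_nhds).symm
  rw [integral_eq_zero_iff_of_nonneg (fun _ => norm_nonneg _) hf.norm] at this
  filter_upwards [this] with t ht
  simpa using ht

/-- A bounded function and an integrable function whose spectra are opposite are orthogonal. -/
theorem integral_mul_eq_zero_of_fourierCoeff {q v : AddCircle τ → ℂ} {K : ℝ}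
    (hq : AEStronglyMeasurable q haarAddCircle) (hK : ∀ᵐ t ∂haarAddCircle, ‖q t‖ ≤ K)
    (hv : Integrable v haarAddCircle)
    (h : ∀ n, fourierCoeff v n = 0 ∨ fourierCoeff q (-n) = 0) :
    ∫ t, q t * v t ∂haarAddCircle = 0 := by
  have hqi : Integrable q haarAddCircle := Integrable.of_bound hq K hK
  have hK0 : 0 ≤ K := by
    obtain ⟨t, ht⟩ := hK.exists
    exact (norm_nonneg _).trans ht
  -- With `v` replaced by a Fejér mean, the integral is a finite combination of products of
  -- coefficient `n` of `v` with coefficient `-n` of `q`.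
  have hz : ∀ m, ∫ t, q t * fejer m v t ∂haarAddCircle = 0 := by
    intro m
    have hi : ∀ (c : ℂ) (n : ℤ), Integrable (fun t => c * (fourier n t * q t)) haarAddCircle :=
      fun c n => (by simpa using hqi.fourier_smul n : Integrable (fun t => fourier n t * q t)
        haarAddCircle).const_mul c
    have he : ∀ t, q t * fejer m v t = ((m : ℂ) + 1)⁻¹ * ∑ a ∈ Finset.range (m + 1),
        ∑ b ∈ Finset.range (m + 1), fourierCoeff v ((a : ℤ) - b) *
          (fourier ((a : ℤ) - b) t * q t) := by
      intro t
      unfold fejer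
      rw [mul_left_comm, Finset.mul_sum]
      congr 1
      refine Finset.sum_congr rfl fun a _ => ?_
      rw [Finset.mul_sum]
      exact Finset.sum_congr rfl fun b _ => by ring
    simp_rw [he]
    rw [integral_const_mul,
      integral_finsetSum _ fun a _ => integrable_finsetSum _ fun b _ => hi _ _,
      Finset.sum_eq_zero, mul_zero]
    intro a _
    rw [integral_finsetSum _ fun b _ => hi _ _]
    refine Finset.sum_eq_zero fun b _ => ?_
    rw [integral_const_mul]
    rcases h ((a : ℤ) - b) with h | h
    · rw [h, zero_mul]
    · rw [fourierCoeff, neg_neg] at h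
      simp only [smul_eq_mul] at h
      rw [h, mul_zero]
  have hbd : ∀ m, ‖∫ t, q t * v t ∂haarAddCircle‖ ≤ K * ∫ t, ‖fejer m v t - v t‖ ∂haarAddCircle := by
    intro m
    have i1 : Integrable (fun t => q t * v t) haarAddCircle := hv.bdd_mul hq hK
    have i2 : Integrable (fun t => q t * fejer m v t) haarAddCircle :=
      (integrable_of_continuous (continuous_fejer m v)).bdd_mul hq hK
    have : ∫ t, q t * v t ∂haarAddCircle = ∫ t, q t * v t - q t * fejer m v t ∂haarAddCircle := by
      rw [integral_sub i1 i2, hz, sub_zero]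
    rw [this, ← integral_const_mul]
    refine norm_integral_le_of_norm_le ((integrable_fejer_sub m hv).norm.const_mul K) ?_
    filter_upwards [hK] with t ht
    rw [← mul_sub, norm_mul, norm_sub_rev]
    gcongr
  have hlim := (tendsto_fejer hv).const_mul K
  rw [mul_zero] at hlim
  exact norm_le_zero_iff.1 (ge_of_tendsto' hlim hbd)

theorem fejer_eq_eval {f : AddCircle τ → ℂ} (hf : ∀ n < 0, fourierCoeff f n = 0) (m : ℕ) :
    ∃ p : Polynomial ℂ, ∀ t, fejer m f t = p.eval (fourier 1 t) := by
  -- The truncation by `toNat` is harmless: it alters only terms of negative frequency, whose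
  -- coefficients vanish.
  refine ⟨Polynomial.C (((m : ℂ) + 1)⁻¹) * ∑ a ∈ Finset.range (m + 1), ∑ b ∈ Finset.range (m + 1),
    Polynomial.C (fourierCoeff f ((a : ℤ) - b)) * Polynomial.X ^ ((a : ℤ) - b).toNat, fun t => ?_⟩
  simp only [fejer, Polynomial.eval_mul, Polynomial.eval_C, Polynomial.eval_finsetSum,
    Polynomial.eval_pow, Polynomial.eval_X]
  congr 1
  refine Finset.sum_congr rfl fun a _ => Finset.sum_congr rfl fun b _ => ?_
  rcases lt_or_ge ((a : ℤ) - b) 0 with h | h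
  · rw [hf _ h, zero_mul, zero_mul]
  · congr 1
    obtain ⟨k, hk⟩ := Int.eq_ofNat_of_zero_le h
    rw [hk]
    simp [fourier_apply, AddCircle.toCircle_nsmul]

theorem integral_fourier_mul_eval {p : Polynomial ℂ} {n : ℤ} (hn : 0 < n) :
    ∫ t : AddCircle τ, fourier n t * p.eval (fourier 1 t) ∂haarAddCircle = 0 := by
  simp_rw [Polynomial.eval_eq_sum_range, Finset.mul_sum]
  rw [integral_finsetSum _ fun a _ => integrable_of_continuous (by fun_prop)]
  refine Finset.sum_eq_zero fun k _ => ?_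
  have : ∀ t : AddCircle τ, fourier n t * (p.coeff k * fourier 1 t ^ k) =
      p.coeff k * fourier (n + k) t := fun t => by
    rw [fourier_add]
    simp [fourier_apply, AddCircle.toCircle_nsmul]
    ring
  simp_rw [this]
  rw [integral_const_mul, integral_fourier, if_neg (by omega), mul_zero]

/-- The exponential series is integrated term by term, dominated by `K ^ k / k!` with `K` a bound of
`p` on the circle; each power of `p` is again a polynomial in `e^{it}`. -/
theorem integral_fourier_mul_exp_eval {p : Polynomial ℂ} {n : ℤ} (hn : 0 < n) :
    ∫ t : AddCircle τ, fourier n t * Complex.exp (p.eval (fourier 1 t)) ∂haarAddCircle = 0 := by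
  have hpc : Continuous fun t : AddCircle τ => p.eval (fourier 1 t) := by fun_prop
  obtain ⟨K, hK⟩ := (isCompact_range hpc).isBounded.exists_norm_le
  have hK' : ∀ t : AddCircle τ, ‖p.eval (fourier 1 t)‖ ≤ K := fun t => hK _ ⟨t, rfl⟩
  have hsum : ∀ t : AddCircle τ, HasSum (fun k : ℕ => fourier n t *
      ((p.eval (fourier 1 t)) ^ k / k.factorial)) (fourier n t *
        Complex.exp (p.eval (fourier 1 t))) := fun t => by
    rw [Complex.exp_eq_exp_ℂ]
    exact (NormedSpace.expSeries_div_hasSum_exp (p.eval (fourier 1 t))).mul_left _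
  have hs := hasSum_integral_of_dominated_convergence (μ := haarAddCircle (T := τ))
    (F := fun (k : ℕ) (t : AddCircle τ) => fourier n t * ((p.eval (fourier 1 t)) ^ k / k.factorial))
    (f := fun t => fourier n t * Complex.exp (p.eval (fourier 1 t)))
    (bound := fun k _ => K ^ k / k.factorial)
    (fun k => (by fun_prop : Continuous fun t : AddCircle τ => fourier n t *
      ((p.eval (fourier 1 t)) ^ k / k.factorial)).aestronglyMeasurable)
    (fun k => Eventually.of_forall fun t => by
      have : ‖fourier n t‖ = 1 := by rw [fourier_apply]; exact Circle.norm_coe _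
      rw [norm_mul, this, one_mul, norm_div, norm_pow, Complex.norm_natCast]
      gcongr
      exact hK' t)
    (Eventually.of_forall fun t => Real.summable_pow_div_factorial K)
    (integrable_const _)
    (Eventually.of_forall hsum)
  have hz : ∀ k : ℕ, ∫ t : AddCircle τ, fourier n t * ((p.eval (fourier 1 t)) ^ k / k.factorial)
      ∂haarAddCircle = 0 := by
    intro k
    have : ∀ t : AddCircle τ, fourier n t * ((p.eval (fourier 1 t)) ^ k / k.factorial) =
        fourier n t * (Polynomial.C ((k.factorial : ℂ)⁻¹) * p ^ k).eval (fourier 1 t) := fun t => by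
      simp only [Polynomial.eval_mul, Polynomial.eval_C, Polynomial.eval_pow]
      ring
    simp_rw [this]
    exact integral_fourier_mul_eval hn
  simp_rw [hz] at hs
  exact (hasSum_zero.unique hs).symm

/-- The exponential of a function of Hardy type with nonpositive real part is of Hardy type. -/
theorem fourierCoeff_exp_neg_eq_zero {χ : AddCircle τ → ℂ} (hχ : Integrable χ haarAddCircle)
    (hneg : ∀ n < 0, fourierCoeff χ n = 0) (hre : ∀ᵐ t ∂haarAddCircle, 0 ≤ (χ t).re) {n : ℤ}
    (hn : n < 0) : fourierCoeff (fun t => Complex.exp (-χ t)) n = 0 := by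
  have hL1 := tendsto_fejer hχ
  have hme : TendstoInMeasure haarAddCircle (fun m => fejer m χ) atTop χ := by
    refine tendstoInMeasure_of_tendsto_eLpNorm one_ne_zero
      (fun m => (continuous_fejer m χ).aestronglyMeasurable) hχ.aestronglyMeasurable ?_
    have : ∀ m, eLpNorm (fejer m χ - χ) 1 haarAddCircle =
        ENNReal.ofReal (∫ t, ‖fejer m χ t - χ t‖ ∂haarAddCircle) := fun m => by
      rw [eLpNorm_one_eq_lintegral_enorm,
        ofReal_integral_norm_eq_lintegral_enorm (integrable_fejer_sub m hχ)]
      rfl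
    simp_rw [this]
    simpa using ENNReal.tendsto_ofReal hL1
  -- Fejér means converge in `L₁`; almost everywhere convergence holds along a subsequence, which is
  -- enough for dominated convergence.
  obtain ⟨ns, -, hns⟩ := hme.exists_seq_tendsto_ae
  have hlim : Tendsto (fun i => ∫ t, fourier (-n) t * Complex.exp (-fejer (ns i) χ t)
      ∂haarAddCircle) atTop (𝓝 (∫ t, fourier (-n) t * Complex.exp (-χ t) ∂haarAddCircle)) := by
    refine tendsto_integral_of_dominated_convergence (fun _ => 1) (fun i => ?_) (integrable_const _)
      (fun i => Eventually.of_forall fun t => ?_) ?_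
    · have := continuous_fejer (ns i) χ
      exact (by fun_prop : Continuous fun t => fourier (-n) t * Complex.exp (-fejer (ns i) χ t)
        ).aestronglyMeasurable
    · have : ‖fourier (-n) t‖ = 1 := by rw [fourier_apply]; exact Circle.norm_coe _
      rw [norm_mul, this, one_mul, Complex.norm_exp, Real.exp_le_one_iff, Complex.neg_re]
      exact neg_nonpos.2 (fejer_re_nonneg (ns i) hχ hre t)
    · filter_upwards [hns] with t ht
      exact ((Complex.continuous_exp.tendsto _).comp ht.neg).const_mul _
  have hz : ∀ i, ∫ t, fourier (-n) t * Complex.exp (-fejer (ns i) χ t) ∂haarAddCircle = 0 := by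
    intro i
    obtain ⟨p, hp⟩ := fejer_eq_eval hneg (ns i)
    have := integral_fourier_mul_exp_eval (τ := τ) (p := -p) (n := -n) (by omega)
    simpa only [hp, Polynomial.eval_neg] using this
  simp_rw [hz] at hlim
  simpa [fourierCoeff] using (tendsto_nhds_unique hlim tendsto_const_nhds)

theorem fourierCoeff_conj (f : AddCircle τ → ℂ) (n : ℤ) :
    fourierCoeff (fun t => conj (f t)) n = conj (fourierCoeff f (-n)) := by
  rw [fourierCoeff, fourierCoeff, ← integral_conj]
  refine integral_congr_ae (Eventually.of_forall fun t => ?_)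
  simp only [smul_eq_mul, map_mul, neg_neg]
  rw [fourier_neg]

/-- A square integrable real function is the real part of a function of Hardy type. -/
theorem exists_hardy_re_eq {φ : AddCircle τ → ℝ} (hφ : MemLp φ 2 haarAddCircle) :
    ∃ χ : AddCircle τ → ℂ, Integrable χ haarAddCircle ∧ (∀ n < 0, fourierCoeff χ n = 0) ∧
      ∀ᵐ t ∂haarAddCircle, (χ t).re = φ t := by
  have hφ' : MemLp (fun t => (φ t : ℂ)) 2 haarAddCircle := hφ.ofReal
  let g : Lp ℂ 2 (haarAddCircle (T := τ)) := hφ'.toLp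
  have hg : g =ᵐ[haarAddCircle] fun t => (φ t : ℂ) := hφ'.coeFn_toLp
  let c : ℤ → ℂ := fourierCoeff fun t => (φ t : ℂ)
  have hc : ∀ n, fourierBasis.repr g n = c n := fun n => by
    rw [fourierBasis_repr, fourierCoeff_congr_ae hg]
  have hcc : ∀ n, conj (c n) = c (-n) := fun n => by
    have := fourierCoeff_conj (fun t => (φ t : ℂ)) (-n)
    rw [neg_neg] at this
    simp only [Complex.conj_ofReal] at this
    exact this.symm
  -- These are the coefficients of `φ` plus `i` times its conjugate function: keep the mean, double
  -- the positive frequencies, drop the negative ones.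
  have hd : Memℓp (fun n : ℤ => if n < 0 then 0 else if n = 0 then c 0 else 2 * c n) 2 := by
    have h1 : Memℓp (fun n => (2 : ℂ) * c n) 2 := by
      have e : (fun n => (2 : ℂ) * c n) = (2 : ℂ) • ⇑(fourierBasis.repr g) := by
        funext n
        change _ = (2 : ℂ) * (fourierBasis.repr g) n
        rw [hc]
      rw [e]
      exact (lp.memℓp (fourierBasis.repr g)).const_smul (2 : ℂ)
    refine memℓp_gen ?_
    refine Summable.of_nonneg_of_le (fun n => by positivity) (fun n => ?_)
      (h1.summable (by norm_num))
    gcongr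
    split_ifs with h h'
    · simp
    · subst h'
      rw [norm_mul]
      have : ‖(2 : ℂ)‖ = 2 := by simp
      rw [this]
      linarith [norm_nonneg (c 0)]
    · rfl
  let χ : Lp ℂ 2 (haarAddCircle (T := τ)) := fourierBasis.repr.symm ⟨_, hd⟩
  have hχ : ∀ n, fourierCoeff χ n = if n < 0 then 0 else if n = 0 then c 0 else 2 * c n :=
    fun n => by
      rw [← fourierBasis_repr, LinearIsometryEquiv.apply_symm_apply]
  have hχi : Integrable χ haarAddCircle := (Lp.memLp χ).integrable (by norm_num)
  have hφi : Integrable (fun t => (φ t : ℂ)) haarAddCircle := hφ'.integrable (by norm_num)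
  refine ⟨χ, hχi, fun n hn => by rw [hχ, if_pos hn], ?_⟩
  have hconj : Integrable (fun t => conj (χ t)) haarAddCircle :=
    (LinearIsometryEquiv.integrable_comp_iff Complex.conjLIE).2 hχi
  -- As `φ` is real, `conj (c n) = c (-n)`, so every coefficient of `χ + conj χ - 2φ` is zero.
  have hz : (⇑χ + fun t => conj (χ t)) + (-2 : ℂ) • (fun t => (φ t : ℂ)) =ᵐ[haarAddCircle] 0 := by
    refine ae_eq_zero_of_fourierCoeff_eq_zero ((hχi.add hconj).add (hφi.smul _)) fun n => ?_
    rw [fourierCoeff.add (hχi.add hconj) (hφi.smul _), fourierCoeff.add hχi hconj]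
    simp only [Pi.add_apply, fourierCoeff.const_smul, fourierCoeff_conj, hχ]
    change _ + (-2 : ℂ) * c n = 0
    rcases lt_trichotomy n 0 with h | h | h
    · rw [if_pos h, if_neg (by omega), if_neg (by omega), map_mul, hcc, neg_neg,
        map_ofNat]
      ring
    · subst h
      simp [hcc]
      ring
    · rw [if_neg (by omega), if_neg (by omega), if_pos (by omega)]
      simp
  filter_upwards [hz] with t ht
  have := congrArg Complex.re ht
  simp at this
  linarith

/-- Smirnov's theorem for scalar products: if `∑ₖ fₖ vₖ` is integrable, where the `fₖ`, `vₖ` are in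
the Hardy space `H₁` and the `vₖ` vanish at the origin, then its integral vanishes. -/
theorem integral_sum_mul_eq_zero_of_hardy {ι : Type*} [Fintype ι] {f v : ι → AddCircle τ → ℂ}
    (hf : ∀ k, Integrable (f k) haarAddCircle) (hv : ∀ k, Integrable (v k) haarAddCircle)
    (hf0 : ∀ k, ∀ n < 0, fourierCoeff (f k) n = 0)
    (hv0 : ∀ k, ∀ n ≤ 0, fourierCoeff (v k) n = 0)
    (hfv : Integrable (fun t => ∑ k, f k t * v k t) haarAddCircle) :
    ∫ t, ∑ k, f k t * v k t ∂haarAddCircle = 0 := by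
  -- Since `w` is integrable, `√w` is in `L₂` and is the real part of a Hardy function `χ`. The
  -- factor `exp (-εχ)` has modulus `exp (-ε√w)`, small enough to make every `f k` bounded.
  let w : AddCircle τ → ℝ := fun t => ∑ k, ‖f k t‖
  have hw : Integrable w haarAddCircle := integrable_finsetSum _ fun k _ => (hf k).norm
  have hw0 : ∀ t, 0 ≤ w t := fun t => Finset.sum_nonneg fun k _ => norm_nonneg _
  have hφ : MemLp (fun t => √(w t)) 2 haarAddCircle := by
    rw [memLp_two_iff_integrable_sq
      (Real.continuous_sqrt.comp_aestronglyMeasurable hw.aestronglyMeasurable)]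
    simpa only [Real.sq_sqrt (hw0 _)] using hw
  obtain ⟨χ, hχi, hχ0, hχre⟩ := exists_hardy_re_eq hφ
  have hO : ∀ ε : ℝ, 0 < ε →
      ∫ t, Complex.exp (-((ε : ℂ) * χ t)) * ∑ k, f k t * v k t ∂haarAddCircle = 0 := by
    intro ε hε
    have hOm : AEStronglyMeasurable (fun t => Complex.exp (-((ε : ℂ) * χ t))) haarAddCircle :=
      Complex.continuous_exp.comp_aestronglyMeasurable (hχi.const_mul (ε : ℂ)).neg.aestronglyMeasurable
    have hOn : ∀ᵐ t ∂haarAddCircle, ‖Complex.exp (-((ε : ℂ) * χ t))‖ = Real.exp (-(ε * √(w t))) := by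
      filter_upwards [hχre] with t ht
      rw [Complex.norm_exp]
      simp [ht]
    have hO1 : ∀ᵐ t ∂haarAddCircle, ‖Complex.exp (-((ε : ℂ) * χ t))‖ ≤ 1 := by
      filter_upwards [hOn] with t ht
      rw [ht, Real.exp_le_one_iff]
      have := Real.sqrt_nonneg (w t)
      nlinarith [mul_nonneg hε.le this]
    have hO0 : ∀ n < 0, fourierCoeff (fun t => Complex.exp (-((ε : ℂ) * χ t))) n = 0 := by
      intro n hn
      refine fourierCoeff_exp_neg_eq_zero (χ := fun t => (ε : ℂ) * χ t) (hχi.const_mul (ε : ℂ))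
        (fun n hn => ?_) ?_ hn
      · rw [fourierCoeff.const_mul, hχ0 n hn, mul_zero]
      · filter_upwards [hχre] with t ht
        simp [ht]
        positivity
    have hOf : ∀ k, ∀ᵐ t ∂haarAddCircle,
        ‖Complex.exp (-((ε : ℂ) * χ t)) * f k t‖ ≤ 2 / ε ^ 2 := by
      intro k
      filter_upwards [hOn] with t ht
      rw [norm_mul, ht]
      have h1 : ‖f k t‖ ≤ w t :=
        Finset.single_le_sum (f := fun k => ‖f k t‖) (fun _ _ => norm_nonneg _) (Finset.mem_univ k)
      -- `s² / 2 ≤ eˢ` with `s = ε√w` is the source of the bound `2 / ε²`.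
      have h2 : (ε * √(w t)) ^ 2 / 2 ≤ Real.exp (ε * √(w t)) := by
        have := Real.quadratic_le_exp_of_nonneg (mul_nonneg hε.le (Real.sqrt_nonneg (w t)))
        have := mul_nonneg hε.le (Real.sqrt_nonneg (w t))
        linarith
      rw [mul_pow, Real.sq_sqrt (hw0 t)] at h2
      rw [Real.exp_neg, inv_mul_le_iff₀ (Real.exp_pos _), mul_div_assoc', le_div_iff₀ (by positivity)]
      nlinarith [mul_le_mul_of_nonneg_left h1 (sq_nonneg ε)]
    have hOfm : ∀ k, AEStronglyMeasurable (fun t => Complex.exp (-((ε : ℂ) * χ t)) * f k t)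
        haarAddCircle := fun k => hOm.mul (hf k).aestronglyMeasurable
    have hOf0 : ∀ k, ∀ n < 0,
        fourierCoeff (fun t => Complex.exp (-((ε : ℂ) * χ t)) * f k t) n = 0 := by
      intro k n hn
      have hi : Integrable (fun t => fourier (-n) t * f k t) haarAddCircle := by
        simpa using (hf k).fourier_smul (-n)
      -- Coefficient `l` of `e^{-int} f k` is coefficient `l + n` of `f k`, of negative index when
      -- `l ≤ 0`; for `l > 0` the factor `exp (-εχ)` has no frequency `-l`.
      have := integral_mul_eq_zero_of_fourierCoeff hOm hO1 hi fun l => by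
        rcases lt_or_ge 0 l with hl | hl
        · exact Or.inr (hO0 _ (by omega))
        · refine Or.inl ?_
          have h := hf0 k (l + n) (by omega)
          rw [fourierCoeff] at h ⊢
          rw [← h]
          refine integral_congr_ae (Eventually.of_forall fun t => ?_)
          simp only [smul_eq_mul]
          rw [neg_add, fourier_add, mul_assoc]
      rw [← this, fourierCoeff]
      refine integral_congr_ae (Eventually.of_forall fun t => ?_)
      simp only [smul_eq_mul]
      ring
    -- After regularization each summand is bounded times integrable, so the sum may be split and
    -- treated termwise.
    have hz : ∀ k, ∫ t, (Complex.exp (-((ε : ℂ) * χ t)) * f k t) * v k t ∂haarAddCircle = 0 := by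
      intro k
      refine integral_mul_eq_zero_of_fourierCoeff (hOfm k) (hOf k) (hv k) fun l => ?_
      rcases lt_or_ge 0 l with hl | hl
      · exact Or.inr (hOf0 k _ (by omega))
      · exact Or.inl (hv0 k l hl)
    have : ∀ t, Complex.exp (-((ε : ℂ) * χ t)) * ∑ k, f k t * v k t =
        ∑ k, (Complex.exp (-((ε : ℂ) * χ t)) * f k t) * v k t := fun t => by
      rw [Finset.mul_sum]
      exact Finset.sum_congr rfl fun k _ => by ring
    simp_rw [this]
    rw [integral_finsetSum _ fun k _ => (hv k).bdd_mul (hOfm k) (hOf k)]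
    exact Finset.sum_eq_zero fun k _ => hz k
  -- As `ε → 0` the modulus of the factor stays at most one, so the whole sum dominates;
  -- integrability of the single products is never used.
  have hlim : Tendsto (fun i : ℕ => ∫ t, Complex.exp (-(((1 / ((i : ℝ) + 1) : ℝ) : ℂ) * χ t)) *
      ∑ k, f k t * v k t ∂haarAddCircle) atTop (𝓝 (∫ t, ∑ k, f k t * v k t ∂haarAddCircle)) := by
    refine tendsto_integral_of_dominated_convergence (fun t => ‖∑ k, f k t * v k t‖) (fun i => ?_)
      hfv.norm (fun i => ?_) ?_
    · exact (Complex.continuous_exp.comp_aestronglyMeasurable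
        (hχi.const_mul _).neg.aestronglyMeasurable).mul hfv.aestronglyMeasurable
    · filter_upwards [hχre] with t ht
      rw [norm_mul]
      refine mul_le_of_le_one_left (norm_nonneg _) ?_
      rw [Complex.norm_exp, Real.exp_le_one_iff, Complex.neg_re, Complex.re_ofReal_mul, ht]
      exact neg_nonpos.2 (by positivity)
    · refine Eventually.of_forall fun t => ?_
      have h1 : Tendsto (fun i : ℕ => ((1 / ((i : ℝ) + 1) : ℝ) : ℂ)) atTop (𝓝 0) := by
        have := (Complex.continuous_ofReal.tendsto 0).comp
          (tendsto_one_div_add_atTop_nhds_zero_nat (𝕜 := ℝ))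
        simpa [Function.comp_def] using this
      have h2 := (h1.mul_const (χ t)).neg
      rw [zero_mul, neg_zero] at h2
      have h3 := ((Complex.continuous_exp.tendsto 0).comp h2).mul_const (∑ k, f k t * v k t)
      rw [Complex.exp_zero, one_mul] at h3
      exact h3
  have hz : ∀ i : ℕ, ∫ t, Complex.exp (-(((1 / ((i : ℝ) + 1) : ℝ) : ℂ) * χ t)) *
      ∑ k, f k t * v k t ∂haarAddCircle = 0 := fun i => hO _ (by positivity)
  simp_rw [hz] at hlim
  exact (tendsto_nhds_unique hlim tendsto_const_nhds)

end Hardy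

/-! ### Passage from the circle to `(-π, π]` -/

section Transfer
open AddCircle Real

theorem ex_add (m n : ℤ) (t : ℝ) : ex (m + n) t = ex m t * ex n t := by
  unfold ex
  rw [← Complex.exp_add]
  congr 1
  push_cast
  ring

@[simp] theorem ex_zero (t : ℝ) : ex 0 t = 1 := by simp [ex]

theorem conj_ex (n : ℤ) (t : ℝ) : conj (ex n t) = ex (-n) t := by
  unfold ex
  rw [← Complex.exp_conj]
  congr 1
  simp

@[simp] theorem norm_ex (n : ℤ) (t : ℝ) : ‖ex n t‖ = 1 := by
  unfold ex
  exact Complex.norm_exp_ofReal_mul_I _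

theorem continuous_ex (n : ℤ) : Continuous (ex n) := by
  unfold ex
  fun_prop

/-- Normalized Lebesgue measure on `(-π, π]`. -/
def nu : Measure ℝ := (ENNReal.ofReal (2 * π))⁻¹ • circ

theorem circ_eq_smul_nu : circ = ENNReal.ofReal (2 * π) • nu := by
  rw [nu, smul_smul, ENNReal.mul_inv_cancel, one_smul]
  · simpa using pi_pos
  · exact ENNReal.ofReal_ne_top

theorem ae_nu_iff {p : ℝ → Prop} : (∀ᵐ t ∂nu, p t) ↔ ∀ᵐ t ∂circ, p t := by
  rw [nu, Measure.ae_ennreal_smul_measure_iff]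
  exact ENNReal.inv_ne_zero.2 ENNReal.ofReal_ne_top

theorem integrable_nu_iff {E : Type*} [NormedAddCommGroup E] {f : ℝ → E} :
    Integrable f nu ↔ Integrable f circ := by
  rw [nu]
  refine integrable_smul_measure (ENNReal.inv_ne_zero.2 ENNReal.ofReal_ne_top) ?_
  rw [Ne, ENNReal.inv_eq_top]
  simpa using pi_pos

theorem mean_eq_integral (f : ℝ → ℂ) : mean f = ∫ t, f t ∂nu := by
  rw [mean, nu, integral_smul_measure, ENNReal.toReal_inv, ENNReal.toReal_ofReal two_pi_pos.le,
    Complex.real_smul]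
  push_cast
  rfl

instance : IsFiniteMeasure nu := by
  have h : IsFiniteMeasure circ := by unfold circ; infer_instance
  have := integrable_nu_iff.2 (integrable_const (μ := circ) (1 : ℝ))
  exact (integrable_const_iff.1 this).resolve_left one_ne_zero

local instance fact_two_pi_pos : Fact (0 < 2 * π) := ⟨two_pi_pos⟩

theorem integral_liftIoc (f : ℝ → ℂ) :
    ∫ x, liftIoc (2 * π) (-π) f x ∂haarAddCircle = mean f := by
  rw [integral_haarAddCircle, ← AddCircle.integral_preimage (2 * π) (-π), mean,
    Complex.real_smul]
  have hs : -π + 2 * π = π := by ring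
  rw [hs, circ]
  congr 1
  · push_cast; rfl
  · refine setIntegral_congr_fun measurableSet_Ioc fun t ht => ?_
    exact liftIoc_coe_apply (by rwa [hs])

theorem integrable_liftIoc {f : ℝ → ℂ} (hf : Integrable f circ) :
    Integrable (liftIoc (2 * π) (-π) f) haarAddCircle := by
  rw [← memLp_one_iff_integrable] at hf ⊢
  rw [memLp_haarAddCircle_iff]
  refine MemLp.memLp_liftIoc ?_
  have hs : -π + 2 * π = π := by ring
  rw [hs]
  exact hf

theorem fourier_eq_liftIoc (n : ℤ) (x : AddCircle (2 * π)) :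
    fourier n x = liftIoc (2 * π) (-π) (ex n) x := by
  obtain ⟨t, ht, rfl⟩ : ∃ t ∈ Set.Ioc (-π) (-π + 2 * π), (t : AddCircle (2 * π)) = x := by
    have := AddCircle.coe_image_Ioc_eq (2 * π) (-π)
    exact this.ge (Set.mem_univ x)
  rw [liftIoc_coe_apply ht, fourier_coe_apply, ex]
  congr 1
  have : (π : ℂ) ≠ 0 := by exact_mod_cast pi_ne_zero
  push_cast
  field_simp

theorem fourierCoeff_liftIoc (f : ℝ → ℂ) (n : ℤ) :
    fourierCoeff (liftIoc (2 * π) (-π) f) n = fourierCo f n := by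
  rw [fourierCoeff, fourierCo, ← integral_liftIoc]
  refine integral_congr_ae (Eventually.of_forall fun x => ?_)
  simp only [fourier_eq_liftIoc, smul_eq_mul]
  rw [mul_comm]
  rfl

/-- Smirnov's theorem for functions on `(-π, π]`. -/
theorem mean_sum_mul_eq_zero_of_hardy {ι : Type*} [Fintype ι] {f v : ι → ℝ → ℂ}
    (hf : ∀ k, Integrable (f k) circ) (hv : ∀ k, Integrable (v k) circ)
    (hf0 : ∀ k, ∀ n < 0, fourierCo (f k) n = 0) (hv0 : ∀ k, ∀ n ≤ 0, fourierCo (v k) n = 0)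
    (hfv : Integrable (fun t => ∑ k, f k t * v k t) circ) :
    mean (fun t => ∑ k, f k t * v k t) = 0 := by
  have e : liftIoc (2 * π) (-π) (fun t => ∑ k, f k t * v k t) =
      fun x => ∑ k, liftIoc (2 * π) (-π) (f k) x * liftIoc (2 * π) (-π) (v k) x := by
    funext x
    simp only [liftIoc, Set.domRestrict_def, Function.comp_apply]
  have h := integrable_liftIoc hfv
  rw [← integral_liftIoc, e]
  rw [e] at h
  refine integral_sum_mul_eq_zero_of_hardy (fun k => integrable_liftIoc (hf k))
    (fun k => integrable_liftIoc (hv k)) (fun k n hn => ?_) (fun k n hn => ?_) h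
  · rw [fourierCoeff_liftIoc, hf0 k n hn]
  · rw [fourierCoeff_liftIoc, hv0 k n hn]

end Transfer

/-! ### Finite combinations and closed spans of indexed families -/

section Comb
variable {T : ℕ} {X Y : Type*}

/-- The linear combination `∑_{j,k} p(j)_k e(j,k)` of a family of vectors. -/
def comb [AddCommGroup X] [Module ℂ X] (e : ℤ → Fin T → X) : (ℤ →₀ (Fin T → ℂ)) →ₗ[ℂ] X :=
  Finsupp.lsum ℂ fun j => ∑ k, (LinearMap.proj k : (Fin T → ℂ) →ₗ[ℂ] ℂ).smulRight (e j k)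

theorem comb_apply [AddCommGroup X] [Module ℂ X] (e : ℤ → Fin T → X) (p : ℤ →₀ (Fin T → ℂ)) :
    comb e p = p.sum fun j v => ∑ k, v k • e j k := by
  rw [comb, Finsupp.lsum_apply]
  exact Finsupp.sum_congr fun j _ => by simp [LinearMap.sum_apply]

theorem comb_single [AddCommGroup X] [Module ℂ X] (e : ℤ → Fin T → X) (j : ℤ) (v : Fin T → ℂ) :
    comb e (Finsupp.single j v) = ∑ k, v k • e j k := by
  rw [comb_apply, Finsupp.sum_single_index]
  simp

theorem comb_single_single [AddCommGroup X] [Module ℂ X] (e : ℤ → Fin T → X) (j : ℤ) (k : Fin T) :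
    comb e (Finsupp.single j (Pi.single k 1)) = e j k := by
  rw [comb_single, Finset.sum_eq_single k]
  · simp
  · intro b _ hb
    simp [hb]
  · simp

theorem map_comb [AddCommGroup X] [Module ℂ X] [AddCommGroup Y] [Module ℂ Y] (f : X →ₗ[ℂ] Y)
    (e : ℤ → Fin T → X) (p : ℤ →₀ (Fin T → ℂ)) : f (comb e p) = comb (fun j k => f (e j k)) p := by
  simp [comb_apply, Finsupp.sum, map_sum]

/-- The span of the vectors `e(j,k)`, `j ∈ I`. -/
def spanIdx [AddCommGroup X] [Module ℂ X] (e : ℤ → Fin T → X) (I : Set ℤ) : Submodule ℂ X :=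
  Submodule.span ℂ {x | ∃ j ∈ I, ∃ k, x = e j k}

theorem mem_spanIdx [AddCommGroup X] [Module ℂ X] {e : ℤ → Fin T → X} {I : Set ℤ} {x : X} :
    x ∈ spanIdx e I ↔ ∃ p : ℤ →₀ (Fin T → ℂ), (p.support : Set ℤ) ⊆ I ∧ comb e p = x := by
  constructor
  · intro hx
    induction hx using Submodule.span_induction with
    | mem x hx =>
      obtain ⟨j, hj, k, rfl⟩ := hx
      refine ⟨Finsupp.single j (Pi.single k 1), fun i hi => ?_, comb_single_single e j k⟩
      have := Finsupp.support_single_subset hi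
      rw [Finset.mem_singleton] at this
      rwa [this]
    | zero => exact ⟨0, by simp, map_zero _⟩
    | add x y _ _ hx hy =>
      obtain ⟨p, hp, rfl⟩ := hx
      obtain ⟨q, hq, rfl⟩ := hy
      classical
      refine ⟨p + q, fun i hi => ?_, map_add _ _ _⟩
      rcases Finset.mem_union.1 (Finsupp.support_add hi) with h | h
      exacts [hp h, hq h]
    | smul c x _ hx =>
      obtain ⟨p, hp, rfl⟩ := hx
      exact ⟨c • p, fun i hi => hp (Finsupp.support_smul hi), map_smul _ _ _⟩
  · rintro ⟨p, hp, rfl⟩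
    rw [comb_apply]
    exact Submodule.sum_mem _ fun j hj => Submodule.sum_mem _ fun k _ =>
      Submodule.smul_mem _ _ (Submodule.subset_span ⟨j, hp hj, k, rfl⟩)

theorem mem_closure_spanIdx [SeminormedAddCommGroup X] [NormedSpace ℂ X] {e : ℤ → Fin T → X}
    {I : Set ℤ} {x : X} : x ∈ (spanIdx e I).topologicalClosure ↔
      ∀ ε : ℝ, 0 < ε → ∃ p : ℤ →₀ (Fin T → ℂ), (p.support : Set ℤ) ⊆ I ∧ ‖x - comb e p‖ < ε := by
  rw [← SetLike.mem_coe, Submodule.topologicalClosure_coe, Metric.mem_closure_iff]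
  refine forall₂_congr fun ε _ => ?_
  constructor
  · rintro ⟨y, hy, h⟩
    obtain ⟨p, hp, rfl⟩ := mem_spanIdx.1 hy
    exact ⟨p, hp, by rwa [← dist_eq_norm]⟩
  · rintro ⟨p, hp, h⟩
    exact ⟨_, mem_spanIdx.2 ⟨p, hp, rfl⟩, by rwa [dist_eq_norm]⟩

theorem exists_seq_tendsto_comb [SeminormedAddCommGroup X] [NormedSpace ℂ X] {e : ℤ → Fin T → X}
    {I : Set ℤ} {x : X} (hx : x ∈ (spanIdx e I).topologicalClosure) :
    ∃ p : ℕ → ℤ →₀ (Fin T → ℂ), (∀ n, ((p n).support : Set ℤ) ⊆ I) ∧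
      Tendsto (fun n => comb e (p n)) atTop (𝓝 x) := by
  have h := fun n : ℕ => mem_closure_spanIdx.1 hx (1 / ((n : ℝ) + 1)) (by positivity)
  choose p hp hpx using h
  refine ⟨p, hp, tendsto_iff_norm_sub_tendsto_zero.2 ?_⟩
  refine squeeze_zero (fun _ => norm_nonneg _) (fun n => ?_) tendsto_one_div_add_atTop_nhds_zero_nat
  rw [norm_sub_rev]
  exact (hpx n).le

variable [NormedAddCommGroup X] [InnerProductSpace ℂ X] [NormedAddCommGroup Y]
  [InnerProductSpace ℂ Y]

theorem inner_comb_right (e : ℤ → Fin T → X) (p : ℤ →₀ (Fin T → ℂ)) (x : X) :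
    inner ℂ x (comb e p) = p.sum fun j v => ∑ k, v k * inner ℂ x (e j k) := by
  simp only [comb_apply, Finsupp.sum, inner_sum, inner_smul_right]

theorem inner_comb_left (e : ℤ → Fin T → X) (p : ℤ →₀ (Fin T → ℂ)) (x : X) :
    inner ℂ (comb e p) x = p.sum fun j v => ∑ k, conj (v k) * inner ℂ (e j k) x := by
  simp only [comb_apply, Finsupp.sum, sum_inner, inner_smul_left]

/-- Inner products of combinations depend only on the Gram matrices; this is the isometry between
the random variables and the spectral model. -/
theorem inner_comb_congr {e e' : ℤ → Fin T → X} {d d' : ℤ → Fin T → Y}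
    (h : ∀ i p j q, inner ℂ (e i p) (e' j q) = inner ℂ (d i p) (d' j q))
    (x y : ℤ →₀ (Fin T → ℂ)) :
    inner ℂ (comb e x) (comb e' y) = inner ℂ (comb d x) (comb d' y) := by
  simp only [inner_comb_left, inner_comb_right, h]

theorem norm_comb_congr {e : ℤ → Fin T → X} {d : ℤ → Fin T → Y}
    (h : ∀ i p j q, inner ℂ (e i p) (e j q) = inner ℂ (d i p) (d j q))
    (x : ℤ →₀ (Fin T → ℂ)) : ‖comb e x‖ = ‖comb d x‖ := by
  have h1 := inner_comb_congr h x x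
  rw [inner_self_eq_norm_sq_to_K, inner_self_eq_norm_sq_to_K] at h1
  have h2 : ‖comb e x‖ ^ 2 = ‖comb d x‖ ^ 2 := by exact_mod_cast h1
  exact (sq_eq_sq₀ (norm_nonneg _) (norm_nonneg _)).1 h2

theorem pairing_eq_inner (e : ℤ → Fin T → X) (w : X) (y : ℤ → Fin T → ℂ) (x : ℤ →₀ (Fin T → ℂ))
    (h : ∀ k ∈ x.support, ∀ p, y k p = inner ℂ (e k p) w) : pairing y x = inner ℂ (comb e x) w := by
  rw [inner_comb_left, pairing]
  refine Finsupp.sum_congr fun k hk => ?_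
  rw [dotProduct]
  refine Finset.sum_congr rfl fun p _ => ?_
  rw [h k hk, mul_comm]
  rfl

theorem inner_eq_zero_of_mem_closure_spanIdx {e : ℤ → Fin T → X} {I : Set ℤ} {x y : X}
    (hx : x ∈ (spanIdx e I).topologicalClosure) (h : ∀ j ∈ I, ∀ k, inner ℂ (e j k) y = 0) :
    inner ℂ x y = 0 := by
  obtain ⟨p, hp, hpx⟩ := exists_seq_tendsto_comb hx
  have h1 : Tendsto (fun n => inner ℂ (comb e (p n)) y) atTop (𝓝 (inner ℂ x y)) :=
    hpx.inner tendsto_const_nhds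
  have h2 : ∀ n, inner ℂ (comb e (p n)) y = 0 := fun n => by
    rw [inner_comb_left]
    refine Finset.sum_eq_zero fun j hj => Finset.sum_eq_zero fun k _ => ?_
    rw [h j (hp n hj), mul_zero]
  simp_rw [h2] at h1
  exact (tendsto_nhds_unique h1 tendsto_const_nhds)

theorem mem_closure_spanIdx_of_forall_inner [CompleteSpace X] {e : ℤ → Fin T → X} {I : Set ℤ}
    {x : X} (h : ∀ y, (∀ j ∈ I, ∀ k, inner ℂ (e j k) y = 0) → inner ℂ y x = 0) :
    x ∈ (spanIdx e I).topologicalClosure := by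
  rw [← Submodule.orthogonal_orthogonal_eq_closure, Submodule.mem_orthogonal]
  intro y hy
  refine h y fun j hj k => ?_
  exact (Submodule.mem_orthogonal _ _).1 hy _ (Submodule.subset_span ⟨j, hj, k, rfl⟩)

/-- `y` is the residual of the orthogonal projection onto the closed span. -/
theorem exists_orthogonal_decomposition [CompleteSpace X] (e : ℤ → Fin T → X) (I : Set ℤ) (x : X) :
    ∃ y, (∀ j ∈ I, ∀ k, inner ℂ (e j k) y = 0) ∧ x - y ∈ (spanIdx e I).topologicalClosure := by
  have : CompleteSpace (spanIdx e I).topologicalClosure :=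
    (Submodule.isClosed_topologicalClosure _).completeSpace_coe
  refine ⟨x - (spanIdx e I).topologicalClosure.starProjection x, fun j hj k => ?_, ?_⟩
  · refine Submodule.inner_right_of_mem_orthogonal
      (K := (spanIdx e I).topologicalClosure) ?_ (Submodule.sub_starProjection_mem_orthogonal x)
    exact Submodule.le_topologicalClosure _ (Submodule.subset_span ⟨j, hj, k, rfl⟩)
  · rw [sub_sub_cancel]
    exact Submodule.starProjection_apply_mem _ x

end Comb

/-! ### The operator inverse and the projection in an abstract Hilbert space -/

section Abstract
variable {T : ℕ} {H : Type*} [NormedAddCommGroup H] [InnerProductSpace ℂ H]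
  {α β : ℤ → Fin T → H} {U : Set ℤ} {X : ℤ → ℤ → Matrix (Fin T) (Fin T) ℂ}

theorem inner_comb_of_biorthogonal
    (hαβ : ∀ k p j q, inner ℂ (α k p) (β j q) = if k = j ∧ p = q then 1 else 0)
    (x : ℤ →₀ (Fin T → ℂ)) (k : ℤ) (p : Fin T) : inner ℂ (α k p) (comb β x) = x k p := by
  rw [inner_comb_right, Finsupp.sum]
  simp_rw [hαβ, mul_ite, mul_one, mul_zero]
  rw [Finset.sum_eq_single k]
  · simp
  · intro j _ hj
    exact Finset.sum_eq_zero fun q _ => if_neg fun h => hj h.1.symm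
  · intro hk
    rw [Finsupp.notMem_support_iff] at hk
    simp [hk]

/-- When the matrix is the Gram matrix of `β`, its energy norm is the Hilbert norm of `comb β x`, so
the energy completion becomes the closed span of `β` over `U`. -/
theorem pairing_blockApply_self (hX : ∀ x k p, blockApply X x k p = inner ℂ (β k p) (comb β x))
    (x : ℤ →₀ (Fin T → ℂ)) : pairing (blockApply X x) x = ((‖comb β x‖ ^ 2 : ℝ) : ℂ) := by
  rw [pairing_eq_inner β (comb β x) _ _ fun k _ p => hX x k p, inner_self_eq_norm_sq_to_K]
  norm_cast

/-- The operator inverse is obtained from the orthogonal projection onto the complement of the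
closed span of `α(j)`, `j ∉ U`, when that complement is the closed span of `β(k)`, `k ∈ U`. -/
theorem isInverseImage_of_biorthogonal [CompleteSpace H] {φ ψ : H} {y : ℤ → Fin T → ℂ}
    (hαβ : ∀ k p j q, inner ℂ (α k p) (β j q) = if k = j ∧ p = q then 1 else 0)
    (hkey : ∀ f g : H, (∀ j ∈ Uᶜ, ∀ q, inner ℂ (α j q) g = 0) →
      (∀ k ∈ U, ∀ p, inner ℂ (β k p) f = 0) → inner ℂ f g = 0)
    (hX : ∀ x k p, blockApply X x k p = inner ℂ (β k p) (comb β x))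
    (hy : ∀ k p, y k p = inner ℂ (β k p) φ)
    (hψ : ∀ j ∈ Uᶜ, ∀ q, inner ℂ (α j q) ψ = 0)
    (hφψ : φ - ψ ∈ (spanIdx α Uᶜ).topologicalClosure) :
    IsInverseImage X U y (fun k p => inner ℂ (α k p) ψ) ((‖ψ‖ ^ 2 : ℝ) : ℂ) ∧
    ∀ c r, IsInverseImage X U y c r →
      c = (fun k p => inner ℂ (α k p) ψ) ∧ r = ((‖ψ‖ ^ 2 : ℝ) : ℂ) := by
  have hβα : ∀ k ∈ U, ∀ p, ∀ j ∈ Uᶜ, ∀ q, inner ℂ (α j q) (β k p) = 0 := fun k hk p j hj q => by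
    rw [hαβ, if_neg]
    rintro ⟨rfl, -⟩
    exact hj hk
  -- `φ - ψ` is in the closed span of the `α j` with `j ∉ U`, to which `β k` is orthogonal by
  -- biorthogonality; hence `β k` pairs equally with `φ` and `ψ`.
  have hyψ : ∀ k ∈ U, ∀ p, inner ℂ (β k p) ψ = y k p := fun k hk p => by
    have h := inner_eq_zero_of_mem_closure_spanIdx hφψ fun j hj q => hβα k hk p j hj q
    rw [← inner_conj_symm, map_eq_zero, inner_sub_right, sub_eq_zero] at h
    rw [hy, h]
  have hφ : inner ℂ ψ φ = ((‖ψ‖ ^ 2 : ℝ) : ℂ) := by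
    have h := inner_eq_zero_of_mem_closure_spanIdx hφψ hψ
    rw [← inner_conj_symm, map_eq_zero, inner_sub_right, sub_eq_zero] at h
    rw [h, inner_self_eq_norm_sq_to_K]
    norm_cast
  -- The only use of the completeness hypothesis `hkey`: whatever is orthogonal to the `β k`, `k ∈
  -- U`, is orthogonal to `ψ`.
  have hmem : ψ ∈ (spanIdx β U).topologicalClosure :=
    mem_closure_spanIdx_of_forall_inner fun f hf => hkey f ψ hψ hf
  refine ⟨⟨fun k hk => funext fun p => hψ k hk p, ?_⟩, ?_⟩
  · obtain ⟨x, hxU, hx⟩ := exists_seq_tendsto_comb hmem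
    refine ⟨x, hxU, fun ε hε => ?_, fun k => ?_, fun k hk => ?_, ?_⟩
    · obtain ⟨n₀, h⟩ := Metric.cauchySeq_iff.1 hx.cauchySeq (√ε) (Real.sqrt_pos.2 hε)
      refine ⟨n₀, fun m hm n hn => ?_⟩
      have := h m hm n hn
      rw [dist_eq_norm, ← map_sub, Real.lt_sqrt (norm_nonneg _)] at this
      rw [pairing_blockApply_self hX, Complex.norm_real, Real.norm_of_nonneg (sq_nonneg _)]
      exact this
    · refine tendsto_pi_nhds.2 fun p => ?_
      have : Tendsto (fun n => inner ℂ (α k p) (comb β (x n))) atTop (𝓝 (inner ℂ (α k p) ψ)) :=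
        tendsto_const_nhds.inner hx
      simpa only [inner_comb_of_biorthogonal hαβ] using this
    · refine tendsto_pi_nhds.2 fun p => ?_
      have : Tendsto (fun n => inner ℂ (β k p) (comb β (x n))) atTop (𝓝 (inner ℂ (β k p) ψ)) :=
        tendsto_const_nhds.inner hx
      rw [hyψ k hk] at this
      simpa only [hX] using this
    · have : Tendsto (fun n => inner ℂ (comb β (x n)) φ) atTop (𝓝 (inner ℂ ψ φ)) :=
        hx.inner tendsto_const_nhds
      rw [hφ] at this
      refine this.congr fun n => ?_
      rw [pairing_eq_inner β φ y _ fun k _ p => hy k p]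
  · rintro c r ⟨-, x, hxU, hcauchy, hxc, hxy, hxr⟩
    have hC : CauchySeq fun n => comb β (x n) := by
      rw [Metric.cauchySeq_iff]
      intro ε hε
      obtain ⟨n₀, h⟩ := hcauchy (ε ^ 2) (by positivity)
      refine ⟨n₀, fun m hm n hn => ?_⟩
      have := h m hm n hn
      rw [pairing_blockApply_self hX, Complex.norm_real, Real.norm_of_nonneg (sq_nonneg _),
        map_sub, ← dist_eq_norm] at this
      exact lt_of_pow_lt_pow_left₀ 2 hε.le this
    obtain ⟨ψ', hψ'⟩ := cauchySeq_tendsto_of_complete hC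
    have hmem' : ψ' ∈ (spanIdx β U).topologicalClosure := by
      refine (Submodule.isClosed_topologicalClosure _).mem_of_tendsto hψ'
        (Eventually.of_forall fun n => ?_)
      exact Submodule.le_topologicalClosure _ (mem_spanIdx.2 ⟨x n, hxU n, rfl⟩)
    have horth : ∀ k ∈ U, ∀ p, inner ℂ (β k p) (ψ' - ψ) = 0 := by
      intro k hk p
      have h1 : Tendsto (fun n => inner ℂ (β k p) (comb β (x n))) atTop (𝓝 (inner ℂ (β k p) ψ')) :=
        tendsto_const_nhds.inner hψ'
      have h2 := tendsto_pi_nhds.1 (hxy k hk) p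
      simp only [hX] at h2
      rw [inner_sub_right, hyψ k hk, tendsto_nhds_unique h1 h2, sub_self]
    -- The difference lies in the closed span of the `β k`, `k ∈ U`, and is orthogonal to each of
    -- them.
    have heq : ψ' = ψ := by
      have := inner_eq_zero_of_mem_closure_spanIdx (Submodule.sub_mem _ hmem' hmem) horth
      rw [inner_self_eq_zero, sub_eq_zero] at this
      exact this
    rw [heq] at hψ'
    constructor
    · funext k p
      have h1 : Tendsto (fun n => inner ℂ (α k p) (comb β (x n))) atTop (𝓝 (inner ℂ (α k p) ψ)) :=
        tendsto_const_nhds.inner hψ'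
      have h2 := tendsto_pi_nhds.1 (hxc k) p
      simp only [inner_comb_of_biorthogonal hαβ] at h1
      exact tendsto_nhds_unique h2 h1
    · have h1 : Tendsto (fun n => inner ℂ (comb β (x n)) φ) atTop (𝓝 (inner ℂ ψ φ)) :=
        hψ'.inner tendsto_const_nhds
      rw [hφ] at h1
      refine tendsto_nhds_unique hxr (h1.congr fun n => ?_)
      rw [pairing_eq_inner β φ y _ fun k _ p => hy k p]

/-- Transport of an orthogonal projection along the isometry `α(j,q) ↦ ζ(j,q)`. -/
theorem exists_isometric_projection {H' : Type*} [NormedAddCommGroup H'] [InnerProductSpace ℂ H']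
    [CompleteSpace H'] {ζ : ℤ → Fin T → H'} {I : Set ℤ} {φ ψ : H} {x : H'}
    (hζ : ∀ i p j q, inner ℂ (ζ i p) (ζ j q) = inner ℂ (α i p) (α j q))
    (hx : ∀ j q, inner ℂ (ζ j q) x = inner ℂ (α j q) φ)
    (hψ : ∀ j ∈ I, ∀ q, inner ℂ (α j q) ψ = 0)
    (hφψ : φ - ψ ∈ (spanIdx α I).topologicalClosure) :
    ∃ y ∈ (spanIdx ζ I).topologicalClosure,
      (∀ z ∈ (spanIdx ζ I).topologicalClosure, inner ℂ z (x - y) = 0) ∧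
      ∀ p, ‖y - comb ζ p‖ = ‖(φ - ψ) - comb α p‖ := by
  -- The same coefficients are used on the `ζ` side; equality of Gram matrices keeps the sequence
  -- Cauchy.
  obtain ⟨p, hpI, hp⟩ := exists_seq_tendsto_comb hφψ
  have hC : CauchySeq fun n => comb ζ (p n) := by
    have := hp.cauchySeq
    rw [Metric.cauchySeq_iff] at this ⊢
    simpa only [dist_eq_norm, ← map_sub, norm_comb_congr hζ] using this
  obtain ⟨y, hy⟩ := cauchySeq_tendsto_of_complete hC
  refine ⟨y, ?_, fun z hz => ?_, fun q => ?_⟩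
  · refine (Submodule.isClosed_topologicalClosure _).mem_of_tendsto hy
      (Eventually.of_forall fun n => ?_)
    exact Submodule.le_topologicalClosure _ (mem_spanIdx.2 ⟨p n, hpI n, rfl⟩)
  · refine inner_eq_zero_of_mem_closure_spanIdx hz fun j hj q => ?_
    have h1 : Tendsto (fun n => inner ℂ (ζ j q) (comb ζ (p n))) atTop (𝓝 (inner ℂ (ζ j q) y)) :=
      tendsto_const_nhds.inner hy
    have h2 : Tendsto (fun n => inner ℂ (α j q) (comb α (p n))) atTop
        (𝓝 (inner ℂ (α j q) (φ - ψ))) := tendsto_const_nhds.inner hp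
    have h3 : ∀ n, inner ℂ (ζ j q) (comb ζ (p n)) = inner ℂ (α j q) (comb α (p n)) := fun n => by
      simp only [inner_comb_right, hζ]
    simp only [h3] at h1
    rw [inner_sub_right, hx, tendsto_nhds_unique h1 h2, inner_sub_right, hψ j hj, sub_zero,
      sub_self]
  · have h1 := (hy.sub_const (comb ζ q)).norm
    have h2 := (hp.sub_const (comb α q)).norm
    simp only [← map_sub, norm_comb_congr hζ] at h1 h2
    exact tendsto_nhds_unique h1 h2

end Abstract

/-! ### Agreement with the bounded inverse on `ℓ₂` -/

section SquareSummable
variable {T : ℕ} {U : Set ℤ} {X : ℤ → ℤ → Matrix (Fin T) (Fin T) ℂ}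

/-- A positive operator with a bounded inverse is bounded below as a quadratic form. -/
theorem norm_sq_le_of_positive_equiv {H : Type*} [NormedAddCommGroup H] [InnerProductSpace ℂ H]
    [CompleteSpace H] (E : H ≃L[ℂ] H)
    (hE : E.toContinuousLinearMap.IsPositive) (z : H) :
    ‖z‖ ^ 2 ≤ ‖(E.symm : H →L[ℂ] H)‖ ^ 2 * ‖(E : H →L[ℂ] H)‖ * ‖inner ℂ z (E z)‖ := by
  set a := ‖(E.symm : H →L[ℂ] H)‖
  set b := ‖(E : H →L[ℂ] H)‖
  have ha : ‖z‖ ≤ a * ‖E z‖ := by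
    simpa using (E.symm : H →L[ℂ] H).le_opNorm (E z)
  have hb : ‖E (E z)‖ ≤ b * ‖E z‖ := (E : H →L[ℂ] H).le_opNorm (E z)
  have key : ‖E z‖ ^ 2 ≤ b * ‖inner ℂ z (E z)‖ := by
    rcases eq_or_lt_of_le (norm_nonneg (E : H →L[ℂ] H)) with h0 | h0
    · have : ‖E z‖ ≤ b * ‖z‖ := (E : H →L[ℂ] H).le_opNorm z
      have hb0 : b = 0 := h0.symm
      rw [hb0, zero_mul] at this
      have h2 : ‖E z‖ = 0 := le_antisymm this (norm_nonneg _)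
      rw [h2, hb0]
      simp
    · have hb0 : 0 < b := h0
      -- Testing positivity at `z - b⁻¹ E z` and using `⟨Ez, E(Ez)⟩ ≤ b ‖Ez‖²` gives `0 ≤ ⟨z, Ez⟩ -
      -- b⁻¹ ‖Ez‖²`.
      have hpos := hE.re_inner_nonneg_right (z - ((b⁻¹ : ℝ) : ℂ) • E z)
      have hsymm : inner ℂ (E z) (E z) = inner ℂ z (E (E z)) :=
        hE.isSymmetric z (E z)
      have hre : (inner ℂ z (E (E z))).re = ‖E z‖ ^ 2 := by
        rw [← hsymm, inner_self_eq_norm_sq_to_K]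
        norm_cast
      have hre2 : (inner ℂ (E z) (E z)).re = ‖E z‖ ^ 2 := by
        rw [hsymm, hre]
      have h3 : (inner ℂ (E z) (E (E z))).re ≤ b * ‖E z‖ ^ 2 := by
        refine (Complex.re_le_norm _).trans ((norm_inner_le_norm _ _).trans ?_)
        nlinarith [norm_nonneg (E z)]
      have h4 : (inner ℂ z (E z)).re ≤ ‖inner ℂ z (E z)‖ := Complex.re_le_norm _
      have hexp : RCLike.re (inner ℂ (z - ((b⁻¹ : ℝ) : ℂ) • E z)
          (E.toContinuousLinearMap (z - ((b⁻¹ : ℝ) : ℂ) • E z))) =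
          (inner ℂ z (E z)).re - 2 * b⁻¹ * ‖E z‖ ^ 2 +
            b⁻¹ ^ 2 * (inner ℂ (E z) (E (E z))).re := by
        have e1 : E.toContinuousLinearMap (z - ((b⁻¹ : ℝ) : ℂ) • E z) =
            E z - ((b⁻¹ : ℝ) : ℂ) • E (E z) := by simp
        rw [e1, inner_sub_left, inner_sub_right, inner_sub_right, inner_smul_left, inner_smul_right,
          inner_smul_left, inner_smul_right, Complex.conj_ofReal, RCLike.re_eq_complex_re]
        simp only [Complex.sub_re, Complex.re_ofReal_mul, hre, hre2]
        ring
      rw [hexp] at hpos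
      have h5 : b⁻¹ ^ 2 * (inner ℂ (E z) (E (E z))).re ≤ b⁻¹ * ‖E z‖ ^ 2 := by
        calc _ ≤ b⁻¹ ^ 2 * (b * ‖E z‖ ^ 2) := by gcongr
          _ = _ := by field_simp
      have h6 : b⁻¹ * ‖E z‖ ^ 2 ≤ ‖inner ℂ z (E z)‖ := by linarith
      rwa [inv_mul_le_iff₀ hb0] at h6
  calc ‖z‖ ^ 2 ≤ (a * ‖E z‖) ^ 2 := by gcongr
    _ = a ^ 2 * ‖E z‖ ^ 2 := by ring
    _ ≤ a ^ 2 * (b * ‖inner ℂ z (E z)‖) := by gcongr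
    _ = _ := by ring

open Classical in
/-- The coordinate vectors of `ℓ₂(U)`, and `0` for indices outside `U`. -/
def coordVec (T : ℕ) (U : Set ℤ) (j : ℤ) (q : Fin T) : SeqL2 T U :=
  if h : j ∈ U then lp.single 2 ⟨j, h⟩ (WithLp.toLp 2 (Pi.single q 1)) else 0

theorem inner_coordVec (j : ℤ) (hj : j ∈ U) (q : Fin T) (z : SeqL2 T U) :
    inner ℂ (coordVec T U j q) z = z ⟨j, hj⟩ q := by
  classical
  rw [coordVec, dif_pos hj, lp.inner_single_left, EuclideanSpace.inner_eq_star_dotProduct]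
  simp

theorem comb_coordVec_apply {x : ℤ →₀ (Fin T → ℂ)} (k : U) : (comb (coordVec T U) x k).ofLp = x k := by
  classical
  funext p
  rw [← inner_coordVec (k : ℤ) k.2 p, inner_comb_right, Finsupp.sum]
  have h : ∀ j q, inner ℂ (coordVec T U (k : ℤ) p) (coordVec T U j q) =
      if (k : ℤ) = j ∧ p = q then 1 else 0 := fun j q => by
    rw [inner_coordVec (k : ℤ) k.2, coordVec]
    split_ifs with h1 h2 h2
    · obtain ⟨h3, rfl⟩ := h2
      have : (⟨j, h1⟩ : U) = k := Subtype.ext h3.symm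
      rw [this]
      simp
    · by_cases h3 : (k : ℤ) = j
      · have h4 : (⟨j, h1⟩ : U) = k := Subtype.ext h3.symm
        have h5 : p ≠ q := fun h => h2 ⟨h3, h⟩
        rw [h4]
        simp [h5]
      · have h4 : k ≠ ⟨j, h1⟩ := fun h => h3 (congrArg Subtype.val h)
        rw [lp.single_apply_ne _ _ _ h4]
        simp
    · exact (h1 (h2.1 ▸ k.2)).elim
    · simp
  simp_rw [h, mul_ite, mul_one, mul_zero]
  rw [Finset.sum_eq_single (k : ℤ)]
  · simp
  · intro j _ hj
    exact Finset.sum_eq_zero fun q _ => if_neg fun h => hj h.1.symm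
  · intro hk
    rw [Finsupp.notMem_support_iff] at hk
    simp [hk]

theorem map_comb_coordVec_apply {E : SeqL2 T U →L[ℂ] SeqL2 T U} (hE : HasBlocks X E)
    {x : ℤ →₀ (Fin T → ℂ)} (hx : (x.support : Set ℤ) ⊆ U) (k : U) :
    (E (comb (coordVec T U) x) k).ofLp = blockApply X x k := by
  classical
  have h := map_comb ((WithLp.linearEquiv 2 ℂ (Fin T → ℂ)).toLinearMap ∘ₗ
    (lp.evalCLM ℂ (fun _ : U => EuclideanSpace ℂ (Fin T)) 2 k).toLinearMap ∘ₗ E.toLinearMap)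
    (coordVec T U) x
  have h' : (E (comb (coordVec T U) x) k).ofLp =
      comb (fun j q => (E (coordVec T U j q) k).ofLp) x := h
  rw [h', comb_apply, blockApply]
  refine Finsupp.sum_congr fun j hj => ?_
  have hj' : j ∈ U := hx hj
  have h2 : ∀ q, (E (coordVec T U j q) k).ofLp = Pi.single q 1 ᵥ* X k j := fun q => by
    rw [coordVec, dif_pos hj']
    exact hE ⟨j, hj'⟩ k _
  simp_rw [h2, ← Matrix.smul_vecMul, ← Matrix.sum_vecMul]
  congr 1
  funext p
  simp [Finset.sum_apply, Pi.single_apply]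

theorem dense_comb_coordVec (z : SeqL2 T U) :
    z ∈ (spanIdx (coordVec T U) U).topologicalClosure := by
  refine mem_closure_spanIdx_of_forall_inner fun w hw => ?_
  have : w = 0 := by
    ext k p
    have := hw k k.2 p
    rw [inner_coordVec (k : ℤ) k.2] at this
    exact this
  rw [this, inner_zero_left]

/-- On the dense finitely supported vectors the quadratic form of `E` is that of the matrix;
nonnegativity passes to limits. -/
theorem isPositive_of_hasBlocks {E : SeqL2 T U →L[ℂ] SeqL2 T U} (hE : HasBlocks X E)
    (hpos : ∀ x : ℤ →₀ (Fin T → ℂ), (x.support : Set ℤ) ⊆ U → 0 ≤ pairing (blockApply X x) x) :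
    E.IsPositive := by
  have hinner : ∀ x : ℤ →₀ (Fin T → ℂ), (x.support : Set ℤ) ⊆ U →
      inner ℂ (comb (coordVec T U) x) (E (comb (coordVec T U) x)) = pairing (blockApply X x) x := by
    intro x hx
    rw [pairing_eq_inner (coordVec T U) (E (comb (coordVec T U) x))]
    intro k hk p
    rw [inner_coordVec k (hx hk), ← map_comb_coordVec_apply hE hx ⟨k, hx hk⟩]
  have h : ∀ z, 0 ≤ inner ℂ z (E z) := by
    intro z
    obtain ⟨x, hxU, hx⟩ := exists_seq_tendsto_comb (dense_comb_coordVec z)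
    have hl : Tendsto (fun n => inner ℂ (comb (coordVec T U) (x n)) (E (comb (coordVec T U) (x n))))
        atTop (𝓝 (inner ℂ z (E z))) := hx.inner ((E.continuous.tendsto z).comp hx)
    refine ge_of_tendsto' hl fun n => ?_
    rw [hinner _ (hxU n)]
    exact hpos _ (hxU n)
  rw [ContinuousLinearMap.isPositive_iff_complex]
  intro z
  have hz := h z
  have h2 : inner ℂ (E z) z = inner ℂ z (E z) := by
    rw [← inner_conj_symm]
    exact Complex.conj_eq_iff_im.2 (Complex.nonneg_iff.1 hz).2.symm
  rw [h2]
  refine ⟨?_, (Complex.nonneg_iff.1 hz).1⟩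
  exact (Complex.eq_re_of_ofReal_le hz).symm

/-- If the block matrix defines an isomorphism of `ℓ₂`, the operator inverse is the inverse of this
isomorphism. -/
theorem IsInverseImage.eq_symm_apply {y c : ℤ → Fin T → ℂ} {r : ℂ}
    (h : IsInverseImage X U y c r)
    (hpos : ∀ x : ℤ →₀ (Fin T → ℂ), (x.support : Set ℤ) ⊆ U → 0 ≤ pairing (blockApply X x) x)
    (E : SeqL2 T U ≃L[ℂ] SeqL2 T U) (hE : HasBlocks X E.toContinuousLinearMap) :
    ∃ z : SeqL2 T U, (∀ k, (z k).ofLp = y k) ∧ (∀ k, (E.symm z k).ofLp = c k) ∧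
      inner ℂ (E.symm z) z = r := by
  obtain ⟨-, x, hxU, hcauchy, hxc, hxy, hxr⟩ := h
  have hEpos := isPositive_of_hasBlocks hE hpos
  have hbd := norm_sq_le_of_positive_equiv E hEpos
  set K := ‖(E.symm : SeqL2 T U →L[ℂ] SeqL2 T U)‖ ^ 2 * ‖(E : SeqL2 T U →L[ℂ] SeqL2 T U)‖
  have hK : 0 ≤ K := by positivity
  have hsub : ∀ m n, ((x m - x n).support : Set ℤ) ⊆ U := by
    classical
    intro m n k hk
    rcases Finset.mem_union.1 (Finsupp.support_sub hk) with h | h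
    exacts [hxU m h, hxU n h]
  have hC : CauchySeq fun n => comb (coordVec T U) (x n) := by
    rw [Metric.cauchySeq_iff]
    intro ε hε
    -- By `hbd`, energy Cauchy implies `ℓ₂` Cauchy; `K + 1` replaces `K` because `K` may be zero.
    obtain ⟨n₀, h⟩ := hcauchy (ε ^ 2 / (K + 1)) (by positivity)
    refine ⟨n₀, fun m hm n hn => ?_⟩
    have h1 := h m hm n hn
    have h2 := hbd (comb (coordVec T U) (x m - x n))
    have h3 : inner ℂ (comb (coordVec T U) (x m - x n)) (E (comb (coordVec T U) (x m - x n))) =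
        pairing (blockApply X (x m - x n)) (x m - x n) := by
      rw [pairing_eq_inner (coordVec T U) (E (comb (coordVec T U) (x m - x n)))]
      intro k hk p
      rw [inner_coordVec k (hsub m n hk)]
      exact (congrFun (map_comb_coordVec_apply hE (hsub m n) ⟨k, hsub m n hk⟩) p).symm
    rw [h3, map_sub, ← dist_eq_norm] at h2
    rw [lt_div_iff₀ (by positivity)] at h1
    refine lt_of_pow_lt_pow_left₀ 2 hε.le ?_
    nlinarith [norm_nonneg (pairing (blockApply X (x m - x n)) (x m - x n))]
  obtain ⟨w, hw⟩ := cauchySeq_tendsto_of_complete hC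
  have heval : ∀ (k : U) {u : ℕ → SeqL2 T U} {v : SeqL2 T U}, Tendsto u atTop (𝓝 v) →
      Tendsto (fun n => (u n k).ofLp) atTop (𝓝 (v k).ofLp) := fun k u v huv =>
    ((PiLp.continuous_ofLp 2 _).tendsto _).comp
      (((lp.evalCLM ℂ (fun _ : U => EuclideanSpace ℂ (Fin T)) 2 k).continuous.tendsto v).comp huv)
  have hy : ∀ k : U, (E w k).ofLp = y k := fun k => by
    refine tendsto_nhds_unique (heval k ((E.continuous.tendsto w).comp hw))
      ((hxy k k.2).congr fun n => ?_)
    exact (map_comb_coordVec_apply hE (hxU n) k).symm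
  refine ⟨E w, hy, fun k => ?_, ?_⟩
  · rw [E.symm_apply_apply]
    refine tendsto_nhds_unique (heval k hw) ((hxc k).congr fun n => ?_)
    exact comb_coordVec_apply k |>.symm
  · rw [E.symm_apply_apply]
    have h1 : Tendsto (fun n => inner ℂ (comb (coordVec T U) (x n)) (E w)) atTop
        (𝓝 (inner ℂ w (E w))) := hw.inner tendsto_const_nhds
    refine tendsto_nhds_unique h1 (hxr.congr fun n => ?_)
    rw [pairing_eq_inner (coordVec T U) (E w)]
    intro k hk p
    rw [inner_coordVec k (hxU n hk), ← hy ⟨k, hxU n hk⟩]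

end SquareSummable

/-! ### The spectral model: modulated rows of the square roots in `L₂` -/

section RowVectors
variable {T : ℕ}

theorem mean_ex (n : ℤ) : mean (ex n) = if n = 0 then 1 else 0 := by
  have := fact_two_pi_pos
  rw [← integral_liftIoc, ← integral_fourier (τ := 2 * Real.pi) n]
  simp_rw [fourier_eq_liftIoc]

theorem mean_congr {f g : ℝ → ℂ} (h : ∀ᵐ t ∂nu, f t = g t) : mean f = mean g := by
  rw [mean_eq_integral, mean_eq_integral, integral_congr_ae h]

theorem fourierCo_conj (f : ℝ → ℂ) (n : ℤ) :
    fourierCo (fun t => conj (f t)) n = conj (fourierCo f (-n)) := by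
  rw [fourierCo, fourierCo, mean_eq_integral, mean_eq_integral, ← integral_conj]
  simp only [map_mul, conj_ex, neg_neg]

/-- The rows of `M` are square integrable. -/
def RowsL2 (M : ℝ → Matrix (Fin T) (Fin T) ℂ) : Prop :=
  ∀ q, MemLp (fun t => (WithLp.toLp 2 (M t q) : EuclideanSpace ℂ (Fin T))) 2 nu

/-- The diagonal entries of `M Mᴴ` are the squared norms of the rows. -/
theorem rowsL2_of_integrable {M : ℝ → Matrix (Fin T) (Fin T) ℂ}
    (hM : ∀ p q, AEMeasurable (fun t => M t p q) nu)
    (h : ∀ q, Integrable (fun t => (M t * (M t)ᴴ) q q) nu) : RowsL2 M := by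
  intro q
  rw [memLp_piLp_iff]
  intro l
  have hm : AEStronglyMeasurable (fun t => M t q l) nu := (hM q l).aestronglyMeasurable
  rw [show (fun t => (WithLp.toLp 2 (M t q) : EuclideanSpace ℂ (Fin T)) l) = fun t => M t q l from rfl,
    memLp_two_iff_integrable_sq_norm hm]
  refine (h q).norm.mono' (hm.norm.pow 2) (Eventually.of_forall fun t => ?_)
  have h1 : (M t * (M t)ᴴ) q q = ((∑ i, ‖M t q i‖ ^ 2 : ℝ) : ℂ) := by
    rw [Matrix.mul_apply]
    push_cast
    exact Finset.sum_congr rfl fun i _ => Complex.mul_conj' _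
  rw [h1, Complex.norm_real, Real.norm_of_nonneg (sq_nonneg _), Real.norm_of_nonneg
    (Finset.sum_nonneg fun i _ => sq_nonneg _)]
  exact Finset.single_le_sum (f := fun i => ‖M t q i‖ ^ 2) (fun i _ => sq_nonneg _)
    (Finset.mem_univ l)

variable {M M' : ℝ → Matrix (Fin T) (Fin T) ℂ}

theorem RowsL2.memLp_smul (hM : RowsL2 M) (j : ℤ) (q : Fin T) :
    MemLp (fun t => ex j t • (WithLp.toLp 2 (M t q) : EuclideanSpace ℂ (Fin T))) 2 nu := by
  refine (hM q).of_le ((continuous_ex j).aestronglyMeasurable.smul (hM q).aestronglyMeasurable)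
    (Eventually.of_forall fun t => ?_)
  rw [norm_smul, norm_ex, one_mul]

/-- The functions `e^{i j t} M_q(t)` as elements of `L₂`, where `M_q` is the row `q` of `M`. -/
def rowVec (M : ℝ → Matrix (Fin T) (Fin T) ℂ) (hM : RowsL2 M) (j : ℤ) (q : Fin T) :
    Lp (EuclideanSpace ℂ (Fin T)) 2 nu :=
  (hM.memLp_smul j q).toLp

theorem coeFn_rowVec (hM : RowsL2 M) (j : ℤ) (q : Fin T) :
    rowVec M hM j q =ᵐ[nu] fun t => ex j t • (WithLp.toLp 2 (M t q) : EuclideanSpace ℂ (Fin T)) :=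
  MemLp.coeFn_toLp _

theorem inner_rowVec_ae (hM : RowsL2 M) (j : ℤ) (q : Fin T)
    (g : Lp (EuclideanSpace ℂ (Fin T)) 2 nu) :
    ∀ᵐ t ∂nu, inner ℂ (rowVec M hM j q t) (g t) = ((g t).ofLp ᵥ* (M t)ᴴ) q * ex (-j) t := by
  filter_upwards [coeFn_rowVec hM j q] with t ht
  rw [ht, inner_smul_left, conj_ex, mul_comm, EuclideanSpace.inner_eq_star_dotProduct]
  rfl

/-- Orthogonality to modulated rows thus becomes a condition on the spectrum of `g Mᴴ`, the form
that Hardy space arguments need. -/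
theorem inner_rowVec (hM : RowsL2 M) (j : ℤ) (q : Fin T) (g : Lp (EuclideanSpace ℂ (Fin T)) 2 nu) :
    inner ℂ (rowVec M hM j q) g = fourierCo (fun t => ((g t).ofLp ᵥ* (M t)ᴴ) q) j := by
  rw [L2.inner_def, fourierCo, mean_eq_integral]
  exact integral_congr_ae (inner_rowVec_ae hM j q g)

theorem integrable_vecMul (hM : RowsL2 M) (q : Fin T) (g : Lp (EuclideanSpace ℂ (Fin T)) 2 nu) :
    Integrable (fun t => ((g t).ofLp ᵥ* (M t)ᴴ) q) nu := by
  refine (L2.integrable_inner (𝕜 := ℂ) (rowVec M hM 0 q) g).congr ?_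
  filter_upwards [inner_rowVec_ae hM 0 q g] with t ht
  rw [ht, neg_zero, ex_zero, mul_one]

theorem inner_rowVec_rowVec (hM : RowsL2 M) (hM' : RowsL2 M') (i j : ℤ) (p q : Fin T) :
    inner ℂ (rowVec M hM i p) (rowVec M' hM' j q) =
      mean fun t => ex (j - i) t * (M' t * (M t)ᴴ) q p := by
  rw [inner_rowVec, fourierCo]
  refine mean_congr ?_
  filter_upwards [coeFn_rowVec hM' j q] with t ht
  rw [ht, sub_eq_add_neg, ex_add, WithLp.ofLp_smul, Matrix.smul_vecMul, Pi.smul_apply, smul_eq_mul]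
  have : (M' t q ᵥ* (M t)ᴴ) p = (M' t * (M t)ᴴ) q p := rfl
  rw [this]
  ring

theorem integrable_mul_conjTranspose (hM : RowsL2 M) (hM' : RowsL2 M') (p q : Fin T) :
    Integrable (fun t => (M' t * (M t)ᴴ) q p) nu := by
  refine (integrable_vecMul hM p (rowVec M' hM' 0 q)).congr ?_
  filter_upwards [coeFn_rowVec hM' 0 q] with t ht
  rw [ht, ex_zero, one_smul]
  rfl

theorem trigPoly_add (x y : ℤ →₀ (Fin T → ℂ)) (t : ℝ) :
    trigPoly (x + y) t = trigPoly x t + trigPoly y t := by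
  classical
  exact Finsupp.sum_add_index (by simp) (by simp)

theorem trigPoly_single (j : ℤ) (v : Fin T → ℂ) (t : ℝ) :
    trigPoly (Finsupp.single j v) t = ex j t • v :=
  Finsupp.sum_single_index (by simp)

theorem continuous_trigPoly (x : ℤ →₀ (Fin T → ℂ)) : Continuous (trigPoly x) := by
  unfold trigPoly Finsupp.sum
  exact continuous_finsetSum _ fun j _ => (continuous_ex j).smul continuous_const

theorem coeFn_comb_rowVec (hM : RowsL2 M) (x : ℤ →₀ (Fin T → ℂ)) :
    comb (rowVec M hM) x =ᵐ[nu] fun t =>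
      (WithLp.toLp 2 (trigPoly x t ᵥ* M t) : EuclideanSpace ℂ (Fin T)) := by
  induction x using Finsupp.induction_linear with
  | zero =>
    rw [map_zero]
    filter_upwards [Lp.coeFn_zero (EuclideanSpace ℂ (Fin T)) 2 nu] with t ht
    rw [ht]
    simp [trigPoly]
  | add x y hx hy =>
    rw [map_add]
    filter_upwards [Lp.coeFn_add (comb (rowVec M hM) x) (comb (rowVec M hM) y), hx, hy] with t ht hx hy
    rw [ht, Pi.add_apply, hx, hy, trigPoly_add, Matrix.add_vecMul]
    rfl
  | single j v =>
    rw [comb_single]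
    have h1 : ∀ᵐ t ∂nu, ∀ k, (v k • rowVec M hM j k : Lp (EuclideanSpace ℂ (Fin T)) 2 nu) t =
        v k • ex j t • (WithLp.toLp 2 (M t k) : EuclideanSpace ℂ (Fin T)) := by
      rw [ae_all_iff]
      intro k
      filter_upwards [Lp.coeFn_smul (v k) (rowVec M hM j k), coeFn_rowVec hM j k] with t h1 h2
      rw [h1, Pi.smul_apply, h2]
    filter_upwards [h1, Lp.coeFn_finsetSum Finset.univ fun k => v k • rowVec M hM j k] with t h1 h2
    rw [h2, Finset.sum_apply]
    simp_rw [h1]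
    ext l
    rw [trigPoly_single, Matrix.smul_vecMul]
    simp only [WithLp.ofLp_sum, WithLp.ofLp_smul, Finset.sum_apply, Pi.smul_apply, smul_eq_mul,
      vecMul, dotProduct, Finset.mul_sum]
    exact Finset.sum_congr rfl fun k _ => by ring

/-- `D` is a measurable Hermitian square root of the weight `V`, with inverse `Di`; `V` and its
inverse are integrable. -/
structure IsWeightRoot (V D Di : ℝ → Matrix (Fin T) (Fin T) ℂ) : Prop where
  aemeasurable : ∀ p q, AEMeasurable (fun t => D t p q) nu
  aemeasurable_inv : ∀ p q, AEMeasurable (fun t => Di t p q) nu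
  integrable : ∀ p q, Integrable (fun t => V t p q) nu
  integrable_inv : ∀ p q, Integrable (fun t => (V t)⁻¹ p q) nu
  isHermitian : ∀ᵐ t ∂nu, (D t)ᴴ = D t
  isHermitian_inv : ∀ᵐ t ∂nu, (Di t)ᴴ = Di t
  mul_self : ∀ᵐ t ∂nu, D t * D t = V t
  mul_self_inv : ∀ᵐ t ∂nu, Di t * Di t = (V t)⁻¹
  mul_inv : ∀ᵐ t ∂nu, D t * Di t = 1
  inv_mul : ∀ᵐ t ∂nu, Di t * D t = 1

theorem aemeasurable_mul {μ : Measure ℝ} {A B : ℝ → Matrix (Fin T) (Fin T) ℂ}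
    (hA : ∀ p q, AEMeasurable (fun t => A t p q) μ)
    (hB : ∀ p q, AEMeasurable (fun t => B t p q) μ) (p q : Fin T) :
    AEMeasurable (fun t => (A t * B t) p q) μ := by
  simp only [Matrix.mul_apply]
  exact Finset.aemeasurable_fun_sum _ fun i _ => (hA p i).mul (hB i q)

/-- `Di` is taken to be `V⁻¹ D`, whose measurability is inherited from `V⁻¹` and `D`; it is the
inverse of the Hermitian `D`, hence Hermitian. -/
theorem exists_isWeightRoot {V : ℝ → Matrix (Fin T) (Fin T) ℂ}
    (hV : ∀ p q, Integrable (fun t => V t p q) nu) (hpos : ∀ᵐ t ∂nu, (V t).PosSemidef)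
    (hunit : ∀ᵐ t ∂nu, IsUnit (V t)) (hinv : ∀ p q, Integrable (fun t => (V t)⁻¹ p q) nu) :
    ∃ D Di, IsWeightRoot V D Di := by
  obtain ⟨D, hD, hDV⟩ := exists_measurable_sqrt (fun p q => (hV p q).aemeasurable) hpos
  have hmul : ∀ᵐ t ∂nu, (V t)⁻¹ * D t * D t = 1 := by
    filter_upwards [hDV, hunit] with t ht hu
    rw [Matrix.mul_assoc, ht.2, Matrix.nonsing_inv_mul _ ((Matrix.isUnit_iff_isUnit_det _).1 hu)]
  have hmul' : ∀ᵐ t ∂nu, D t * ((V t)⁻¹ * D t) = 1 := by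
    filter_upwards [hmul] with t ht
    exact mul_eq_one_comm.1 ht
  refine ⟨D, fun t => (V t)⁻¹ * D t, hD, aemeasurable_mul (fun p q => (hinv p q).aemeasurable) hD,
    hV, hinv, hDV.mono fun t ht => ht.1, ?_, hDV.mono fun t ht => ht.2, ?_, hmul', hmul⟩
  · filter_upwards [hDV, hmul, hmul'] with t ht h h'
    have h1 : ((V t)⁻¹ * D t)ᴴ * D t = 1 := by
      have := congrArg conjTranspose h'
      rwa [Matrix.conjTranspose_mul, ht.1, Matrix.conjTranspose_one] at this
    exact left_inv_eq_right_inv h1 h'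
  · filter_upwards [hDV, hmul, hmul'] with t ht h h'
    refine (Matrix.inv_eq_right_inv ?_).symm
    calc V t * ((V t)⁻¹ * D t * ((V t)⁻¹ * D t))
        = D t * (D t * ((V t)⁻¹ * D t)) * ((V t)⁻¹ * D t) := by rw [← ht.2]; noncomm_ring
      _ = 1 := by rw [h', mul_one, h']

variable {V D Di : ℝ → Matrix (Fin T) (Fin T) ℂ}

theorem IsWeightRoot.rowsL2 (h : IsWeightRoot V D Di) : RowsL2 D := by
  refine rowsL2_of_integrable h.aemeasurable fun q => (h.integrable q q).congr ?_
  filter_upwards [h.isHermitian, h.mul_self] with t h1 h2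
  rw [h1, h2]

theorem IsWeightRoot.rowsL2_inv (h : IsWeightRoot V D Di) : RowsL2 Di := by
  refine rowsL2_of_integrable h.aemeasurable_inv fun q => (h.integrable_inv q q).congr ?_
  filter_upwards [h.isHermitian_inv, h.mul_self_inv] with t h1 h2
  rw [h1, h2]

theorem IsWeightRoot.biorthogonal (h : IsWeightRoot V D Di) (k : ℤ) (p : Fin T) (j : ℤ)
    (q : Fin T) : inner ℂ (rowVec D h.rowsL2 k p) (rowVec Di h.rowsL2_inv j q) =
      if k = j ∧ p = q then 1 else 0 := by
  rw [inner_rowVec_rowVec]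
  have h1 : mean (fun t => ex (j - k) t * (Di t * (D t)ᴴ) q p) =
      mean (fun t => ex (j - k) t * (1 : Matrix (Fin T) (Fin T) ℂ) q p) := by
    refine mean_congr ?_
    filter_upwards [h.isHermitian, h.inv_mul] with t h1 h2
    rw [h1, h2]
  rw [h1, mean_eq_integral, integral_mul_const, ← mean_eq_integral, mean_ex, Matrix.one_apply]
  rcases eq_or_ne k j with rfl | hkj <;> rcases eq_or_ne p q with rfl | hpq
  · simp
  · simp [hpq, hpq.symm]
  · have : j - k ≠ 0 := sub_ne_zero.2 hkj.symm
    simp [this, hkj]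
  · simp [hkj, hpq.symm]

/-- Elements of `L₂` with complementary spectra are orthogonal. -/
theorem IsWeightRoot.inner_eq_zero_of_halfline (h : IsWeightRoot V D Di)
    {f g : Lp (EuclideanSpace ℂ (Fin T)) 2 nu}
    (hg : ∀ j < 0, ∀ q, inner ℂ (rowVec D h.rowsL2 j q) g = 0)
    (hf : ∀ k, 0 ≤ k → ∀ p, inner ℂ (rowVec Di h.rowsL2_inv k p) f = 0) : inner ℂ f g = 0 := by
  -- Inserting `D Di = 1` splits the inner product into factors with controlled spectra: none of
  -- `gD` in `n < 0`, none of `conj (f Di)` in `n ≤ 0`.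
  have hae : ∀ᵐ t ∂nu, inner ℂ (f t) (g t) =
      ∑ q, ((g t).ofLp ᵥ* (D t)ᴴ) q * conj (((f t).ofLp ᵥ* (Di t)ᴴ) q) := by
    filter_upwards [h.isHermitian, h.mul_inv] with t h1 h2
    have : ∑ q, ((g t).ofLp ᵥ* (D t)ᴴ) q * conj (((f t).ofLp ᵥ* (Di t)ᴴ) q) =
        ((g t).ofLp ᵥ* (D t)ᴴ) ⬝ᵥ star ((f t).ofLp ᵥ* (Di t)ᴴ) := rfl
    rw [this, Matrix.star_vecMul, Matrix.conjTranspose_conjTranspose, ← Matrix.dotProduct_mulVec,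
      Matrix.mulVec_mulVec, h1, h2, Matrix.one_mulVec, EuclideanSpace.inner_eq_star_dotProduct]
  have hi := (L2.integrable_inner (𝕜 := ℂ) f g).congr hae
  rw [L2.inner_def, integral_congr_ae hae, ← mean_eq_integral]
  refine mean_sum_mul_eq_zero_of_hardy
    (f := fun q t => ((g t).ofLp ᵥ* (D t)ᴴ) q) (v := fun q t => conj (((f t).ofLp ᵥ* (Di t)ᴴ) q))
    (fun q => integrable_nu_iff.1 (integrable_vecMul h.rowsL2 q g))
    (fun q => integrable_nu_iff.1 ((LinearIsometryEquiv.integrable_comp_iff Complex.conjLIE).2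
      (integrable_vecMul h.rowsL2_inv q f))) (fun q n hn => ?_) (fun q n hn => ?_)
    (integrable_nu_iff.1 hi)
  · rw [← inner_rowVec h.rowsL2, hg n hn q]
  · rw [fourierCo_conj, ← inner_rowVec h.rowsL2_inv, hf (-n) (by omega) q, map_zero]

/-- Reduction to the half-line: by biorthogonality a finite combination of `Di` rows with negative
indices in `U` removes the remaining negative coordinates of `g`, and `f` is orthogonal to that
combination. -/
theorem IsWeightRoot.inner_eq_zero (h : IsWeightRoot V D Di) {U : Set ℤ}
    (hU : ∀ k, 0 ≤ k → k ∈ U) (hfin : {k ∈ U | k < 0}.Finite)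
    {f g : Lp (EuclideanSpace ℂ (Fin T)) 2 nu}
    (hg : ∀ j ∈ Uᶜ, ∀ q, inner ℂ (rowVec D h.rowsL2 j q) g = 0)
    (hf : ∀ k ∈ U, ∀ p, inner ℂ (rowVec Di h.rowsL2_inv k p) f = 0) : inner ℂ f g = 0 := by
  classical
  let x : ℤ →₀ (Fin T → ℂ) := Finsupp.onFinset hfin.toFinset
    (fun k => if k ∈ hfin.toFinset then fun q => inner ℂ (rowVec D h.rowsL2 k q) g else 0)
    fun k hk => by
      by_contra hn
      exact hk (if_neg hn)
  have h1 : inner ℂ f (g - comb (rowVec Di h.rowsL2_inv) x) = 0 := by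
    refine h.inner_eq_zero_of_halfline (fun j hj q => ?_) fun k hk => hf k (hU k hk)
    rw [inner_sub_right, inner_comb_of_biorthogonal h.biorthogonal, Finsupp.onFinset_apply]
    split_ifs with hj'
    · rw [sub_self]
    · rw [Pi.zero_apply, sub_zero]
      refine hg j (fun hjU => hj' ?_) q
      rw [Set.Finite.mem_toFinset]
      exact ⟨hjU, hj⟩
  have h2 : inner ℂ f (comb (rowVec Di h.rowsL2_inv) x) = 0 := by
    rw [inner_comb_right]
    refine Finset.sum_eq_zero fun k hk => Finset.sum_eq_zero fun q _ => ?_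
    have hkU : k ∈ U := by
      have := Finsupp.support_onFinset_subset hk
      rw [Set.Finite.mem_toFinset] at this
      exact this.1
    rw [← inner_conj_symm, hf k hkU, map_zero, mul_zero]
  rw [inner_sub_right, h2, sub_zero] at h1
  exact h1

theorem dotProduct_mulVec_star {W B : Matrix (Fin T) (Fin T) ℂ} (hB : Bᴴ = B) (hBW : B * B = W)
    (v w : Fin T → ℂ) : v ⬝ᵥ (W *ᵥ star w) = (v ᵥ* B) ⬝ᵥ star (w ᵥ* B) := by
  rw [Matrix.star_vecMul, hB, ← Matrix.dotProduct_mulVec, Matrix.mulVec_mulVec, hBW]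

theorem dotProduct_star_self (v : Fin T → ℂ) :
    v ⬝ᵥ star v = ((‖(WithLp.toLp 2 v : EuclideanSpace ℂ (Fin T))‖ ^ 2 : ℝ) : ℂ) := by
  have := inner_self_eq_norm_sq_to_K (𝕜 := ℂ) (WithLp.toLp 2 v : EuclideanSpace ℂ (Fin T))
  rw [EuclideanSpace.inner_eq_star_dotProduct] at this
  rw [this]
  norm_cast

/-- `f ↦ f D` carries `L₂(V)` into the unweighted `L₂`; the factor `2π` comes from normalizing the
measure. -/
theorem IsWeightRoot.weightedSq_eq (h : IsWeightRoot V D Di) (f : ℝ → Fin T → ℂ) :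
    weightedSq V f = ENNReal.ofReal (2 * Real.pi) *
      eLpNorm (fun t => (WithLp.toLp 2 (f t ᵥ* D t) : EuclideanSpace ℂ (Fin T))) 2 nu ^ 2 := by
  have h2 := eLpNorm_nnreal_pow_eq_lintegral (μ := nu) (p := 2) two_ne_zero
    (f := fun t => (WithLp.toLp 2 (f t ᵥ* D t) : EuclideanSpace ℂ (Fin T)))
  simp only [NNReal.coe_ofNat, ENNReal.coe_ofNat, ENNReal.rpow_ofNat] at h2
  rw [h2, weightedSq, circ_eq_smul_nu, lintegral_smul_measure, smul_eq_mul]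
  congr 1
  refine lintegral_congr_ae ?_
  filter_upwards [h.isHermitian, h.mul_self] with t h1 h2
  rw [dotProduct_mulVec_star h1 h2, dotProduct_star_self, Complex.ofReal_re,
    ENNReal.ofReal_pow (norm_nonneg _), ofReal_norm]

end RowVectors

/-! ### Block matrices as Gram matrices; the index sets -/

section Blocks
variable {T : ℕ} {H : Type*} [NormedAddCommGroup H] [InnerProductSpace ℂ H]

/-- The reflection `j ↦ -j` of a finitely supported sequence. -/
def reflect (x : ℤ →₀ (Fin T → ℂ)) : ℤ →₀ (Fin T → ℂ) :=
  Finsupp.embDomain (Equiv.neg ℤ).toEmbedding x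

theorem comb_reflect {X : Type*} [AddCommGroup X] [Module ℂ X] (e : ℤ → Fin T → X)
    (x : ℤ →₀ (Fin T → ℂ)) : comb e (reflect x) = comb (fun j => e (-j)) x := by
  rw [comb_apply, comb_apply, reflect, Finsupp.sum_embDomain]
  rfl

theorem blockApply_eq_inner {X : ℤ → ℤ → Matrix (Fin T) (Fin T) ℂ} {b e : ℤ → Fin T → H}
    (h : ∀ k j q p, X k j q p = inner ℂ (b k p) (e j q)) (x : ℤ →₀ (Fin T → ℂ)) (k : ℤ)
    (p : Fin T) : blockApply X x k p = inner ℂ (b k p) (comb e x) := by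
  rw [inner_comb_right, blockApply, Finsupp.sum, Finset.sum_apply, Finsupp.sum]
  refine Finset.sum_congr rfl fun j _ => ?_
  rw [vecMul, dotProduct]
  exact Finset.sum_congr rfl fun q _ => by rw [h]

theorem quadForm_eq_inner {X : ℤ → ℤ → Matrix (Fin T) (Fin T) ℂ} {e : ℤ → Fin T → H}
    (h : ∀ k j p q, X k j p q = inner ℂ (e j q) (e k p)) (x : ℤ →₀ (Fin T → ℂ)) :
    quadForm X x = inner ℂ (comb e x) (comb e x) := by
  rw [inner_comb_right, quadForm]
  refine Finsupp.sum_congr fun k _ => ?_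
  simp_rw [inner_comb_left, Finsupp.sum, Finset.mul_sum]
  rw [Finset.sum_comm]
  refine Finset.sum_congr rfl fun j _ => ?_
  simp_rw [dotProduct, mulVec, dotProduct, Finset.mul_sum, h]
  refine Finset.sum_congr rfl fun p _ => Finset.sum_congr rfl fun q _ => ?_
  rw [mul_comm (inner ℂ _ _)]
  rfl

theorem quadForm_sub (X X' : ℤ → ℤ → Matrix (Fin T) (Fin T) ℂ) (x : ℤ →₀ (Fin T → ℂ)) :
    quadForm (X - X') x = quadForm X x - quadForm X' x := by
  simp only [quadForm, Finsupp.sum, Pi.sub_apply, Matrix.sub_mulVec, dotProduct_sub,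
    Finset.sum_sub_distrib]

theorem sum_truncVec {s : ℕ} {X : Type*} [AddCommMonoid X] (M L : Fin s → ℕ) (N : ℕ)
    (a : ℤ → Fin T → ℂ) (g : ℤ → (Fin T → ℂ) → X) (hg : ∀ j, g j 0 = 0) :
    (truncVec M L N a).sum g = ∑ j ∈ truncIdx M L N, g j (a j) := by
  classical
  rw [truncVec, Finsupp.onFinset_sum _ hg]
  have h1 : truncIdx M L N ⊆ Finset.Icc (0 : ℤ) N := Finset.filter_subset _ _
  rw [← Finset.sum_subset h1]
  · exact Finset.sum_congr rfl fun j hj => by rw [if_pos hj]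
  · intro j _ hj
    rw [if_neg hj, hg]

theorem symbolA_eq_trigPoly {s : ℕ} (M L : Fin s → ℕ) (N : ℕ) (a : ℤ → Fin T → ℂ) (t : ℝ) :
    symbolA M L N a t = trigPoly (reflect (truncVec M L N a)) t := by
  rw [trigPoly, reflect, Finsupp.sum_embDomain, sum_truncVec]
  · rfl
  · simp

theorem functional_eq_comb {s : ℕ} {Ω : Type*} [MeasurableSpace Ω] {P : Measure Ω}
    (M L : Fin s → ℕ) (N : ℕ) (a : ℤ → Fin T → ℂ) (ξ : ℤ → Fin T → Lp ℂ 2 P) :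
    functional M L N a ξ = comb ξ (reflect (truncVec M L N a)) := by
  rw [comb_reflect, comb_apply, sum_truncVec]
  · rfl
  · simp

theorem compl_unobsIdx {s : ℕ} (M L : Fin s → ℕ) : (unobsIdx M L)ᶜ = obsIdx M L := by
  ext j
  simp only [unobsIdx, obsIdx, Set.mem_compl_iff, Set.mem_union, Set.mem_sdiff, Set.mem_ofPred_eq,
    not_or, not_le]
  tauto

/-- Finiteness of the missing blocks is what allows the reduction to the half-line. -/
theorem finite_unobsIdx_neg {s : ℕ} (M L : Fin s → ℕ) : {k ∈ unobsIdx M L | k < 0}.Finite := by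
  refine (Set.finite_iUnion fun l : Fin s =>
    Set.finite_Icc (-((M l : ℤ) + L l)) (-(M l : ℤ))).subset ?_
  rintro k ⟨hk | hk, hk0⟩
  · obtain ⟨l, h1, h2⟩ := hk
    exact Set.mem_iUnion.2 ⟨l, h1, h2⟩
  · exact (not_lt.2 hk hk0).elim

end Blocks

/-! ### Covariances of the stationary sequences -/

section Stationary
variable {T : ℕ} {Ω : Type*} [MeasurableSpace Ω] {P : Measure Ω}
  {F G : ℝ → Matrix (Fin T) (Fin T) ℂ} {ξ η : ℤ → Fin T → Lp ℂ 2 P}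

theorem integral_mul_conj_eq_inner (x y : Lp ℂ 2 P) : ∫ ω, x ω * conj (y ω) ∂P = inner ℂ y x := by
  rw [L2.inner_def]
  rfl

theorem IsStationary.inner_eq (hξ : IsStationary P ξ F) (i j : ℤ) (p q : Fin T) :
    inner ℂ (ξ i p) (ξ j q) = mean fun t => ex (j - i) t * F t q p := by
  rw [← hξ.covariance (j - i) i q p, add_sub_cancel, integral_mul_conj_eq_inner]

theorem Uncorrelated.inner_right (h : Uncorrelated ξ η) (i j : ℤ) (p q : Fin T) :
    inner ℂ (η j q) (ξ i p) = 0 := by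
  rw [← integral_mul_conj_eq_inner, h]

theorem Uncorrelated.inner_left (h : Uncorrelated ξ η) (i j : ℤ) (p q : Fin T) :
    inner ℂ (ξ i p) (η j q) = 0 := by
  rw [← inner_conj_symm, h.inner_right, map_zero]

theorem integrable_ex_mul {f : ℝ → ℂ} (hf : Integrable f nu) (n : ℤ) :
    Integrable (fun t => ex n t * f t) nu :=
  hf.bdd_mul (c := 1) (continuous_ex n).aestronglyMeasurable
    (Eventually.of_forall fun t => (norm_ex n t).le)

theorem inner_add_of_uncorrelated (hξ : IsStationary P ξ F) (hη : IsStationary P η G)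
    (h : Uncorrelated ξ η) (i j : ℤ) (p q : Fin T) :
    inner ℂ ((ξ + η) i p) ((ξ + η) j q) = mean fun t => ex (j - i) t * (F t + G t) q p := by
  simp only [Pi.add_apply]
  rw [inner_add_left, inner_add_right, inner_add_right, h.inner_left, h.inner_right, hξ.inner_eq,
    hη.inner_eq, add_zero, zero_add, mean_eq_integral, mean_eq_integral, mean_eq_integral,
    ← integral_add (integrable_ex_mul (integrable_nu_iff.2 (hξ.density.integrable q p)) _)
      (integrable_ex_mul (integrable_nu_iff.2 (hη.density.integrable q p)) _)]
  simp only [Matrix.add_apply, mul_add]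

end Stationary

/-! ### The parallel sum `A (A + B)⁻¹ B` -/

section ParallelSum
variable {T : ℕ}

theorem sub_mul_inv_mul_self_eq {A B : Matrix (Fin T) (Fin T) ℂ} (hu : IsUnit (A + B)) :
    A - A * (A + B)⁻¹ * A = A * (A + B)⁻¹ * B := by
  have h : A * (A + B)⁻¹ * (A + B) = A := by
    rw [Matrix.mul_assoc, Matrix.nonsing_inv_mul _ ((Matrix.isUnit_iff_isUnit_det _).1 hu), mul_one]
  rw [mul_add] at h
  exact sub_eq_of_eq_add' h.symm

theorem posSemidef_sub_mul_inv_mul_self {A B : Matrix (Fin T) (Fin T) ℂ} (hA : A.PosSemidef)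
    (hB : B.PosSemidef) (hu : IsUnit (A + B)) : (A - A * (A + B)⁻¹ * A).PosSemidef := by
  set W := (A + B)⁻¹ with hW
  have hWV : W * (A + B) = 1 := Matrix.nonsing_inv_mul _ ((Matrix.isUnit_iff_isUnit_det _).1 hu)
  have hWh : Wᴴ = W := by
    rw [hW, Matrix.conjTranspose_nonsing_inv, (hA.1.add hB.1).eq]
  -- The error covariance of estimating a signal with covariance `A` in noise `B` by the filter `A
  -- W`, a sum of two positive semidefinite terms.
  have e : A - A * W * A = (1 - A * W) * A * (1 - A * W)ᴴ + (A * W) * B * (A * W)ᴴ := by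
    have h1 : A * (W * (A + B)) * W * A = A * W * A := by rw [hWV, mul_one]
    rw [Matrix.conjTranspose_sub, Matrix.conjTranspose_one, Matrix.conjTranspose_mul, hWh, hA.1.eq]
    have h2 : (1 - A * W) * A * (1 - W * A) + A * W * B * (W * A) =
        A - 2 • (A * W * A) + A * (W * (A + B)) * W * A := by noncomm_ring
    rw [h2, h1]
    noncomm_ring
  rw [e]
  exact (hA.mul_mul_conjTranspose_same _).add (hB.mul_mul_conjTranspose_same _)

end ParallelSum

/-! ### The mean-square error as a Hilbert space expression -/

section MeanSquareError
variable {T : ℕ} {F G D Di DF : ℝ → Matrix (Fin T) (Fin T) ℂ}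

theorem aemeasurable_vecMul {v : ℝ → Fin T → ℂ} {B : ℝ → Matrix (Fin T) (Fin T) ℂ}
    (hv : AEMeasurable v nu) (hB : ∀ p q, AEMeasurable (fun t => B t p q) nu) :
    AEMeasurable (fun t => v t ᵥ* B t) nu := by
  refine aemeasurable_pi_lambda _ fun q => ?_
  simp only [vecMul, dotProduct]
  exact Finset.aemeasurable_fun_sum _ fun i _ =>
    ((measurable_pi_apply i).comp_aemeasurable hv).mul (hB i q)

theorem aemeasurable_dotProduct_mulVec {v : ℝ → Fin T → ℂ} {B : ℝ → Matrix (Fin T) (Fin T) ℂ}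
    (hv : AEMeasurable v nu) (hB : ∀ p q, AEMeasurable (fun t => B t p q) nu) :
    AEMeasurable (fun t => v t ⬝ᵥ (B t *ᵥ star (v t))) nu := by
  have h := aemeasurable_vecMul hv hB
  have e : (fun t => v t ⬝ᵥ (B t *ᵥ star (v t))) = fun t => ∑ i, (v t ᵥ* B t) i * conj (v t i) := by
    funext t
    rw [Matrix.dotProduct_mulVec]
    rfl
  rw [e]
  exact Finset.aemeasurable_fun_sum _ fun i _ =>
    ((measurable_pi_apply i).comp_aemeasurable h).mul
      (Complex.continuous_conj.measurable.comp_aemeasurable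
        ((measurable_pi_apply i).comp_aemeasurable hv))

theorem dotProduct_mulVec_star_nonneg {B : Matrix (Fin T) (Fin T) ℂ} (hB : B.PosSemidef)
    (v : Fin T → ℂ) : 0 ≤ v ⬝ᵥ (B *ᵥ star v) := by
  simpa using hB.dotProduct_mulVec_nonneg (star v)

theorem integrable_norm_sq_Lp {α E : Type*} [MeasurableSpace α] [NormedAddCommGroup E]
    {μ : Measure α} (u : Lp E 2 μ) : Integrable (fun t => ‖u t‖ ^ 2) μ :=
  (memLp_two_iff_integrable_sq_norm (Lp.memLp u).1).1 (Lp.memLp u)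

theorem ofReal_norm_sq_eq_inner {E : Type*} [NormedAddCommGroup E] [InnerProductSpace ℂ E]
    (u : E) : ((‖u‖ ^ 2 : ℝ) : ℂ) = inner ℂ u u := by
  rw [inner_self_eq_norm_sq_to_K]
  norm_cast

/-- A quadratic form is integrable when it is dominated by the weight. -/
theorem IsWeightRoot.integrable_quadratic (h : IsWeightRoot (F + G) D Di)
    (hFm : ∀ p q, AEMeasurable (fun t => F t p q) nu)
    (hF : ∀ᵐ t ∂nu, (F t).PosSemidef) (hG : ∀ᵐ t ∂nu, (G t).PosSemidef) {f : ℝ → Fin T → ℂ}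
    (hf : AEMeasurable f nu) {u : Lp (EuclideanSpace ℂ (Fin T)) 2 nu}
    (hu : ∀ᵐ t ∂nu, f t ᵥ* D t = (u t).ofLp) :
    Integrable (fun t => f t ⬝ᵥ (F t *ᵥ star (f t))) nu := by
  refine (integrable_norm_sq_Lp u).mono'
    (aemeasurable_dotProduct_mulVec hf hFm).aestronglyMeasurable ?_
  filter_upwards [hF, hG, hu, h.isHermitian, h.mul_self] with t hF hG hu h1 h2
  have h3 : f t ⬝ᵥ ((F + G) t *ᵥ star (f t)) = ((‖u t‖ ^ 2 : ℝ) : ℂ) := by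
    rw [dotProduct_mulVec_star h1 h2, hu, dotProduct_star_self]
  rw [Pi.add_apply, Matrix.add_mulVec, dotProduct_add] at h3
  have h4 := dotProduct_mulVec_star_nonneg hF (f t)
  have h5 := dotProduct_mulVec_star_nonneg hG (f t)
  have h6 := congrArg Complex.re h3
  rw [Complex.add_re, Complex.ofReal_re] at h6
  have h7 := (Complex.nonneg_iff.1 h5).1
  rw [Complex.eq_re_of_ofReal_le h4, Complex.norm_real,
    Real.norm_of_nonneg (Complex.nonneg_iff.1 h4).1]
  linarith

/-- The squared row norms are the diagonal of `F (F + G)⁻¹ F`, which the parallel sum inequality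
bounds by that of the integrable `F`. -/
theorem IsWeightRoot.rowsL2_mul (h : IsWeightRoot (F + G) D Di)
    (hFi : ∀ p q, Integrable (fun t => F t p q) nu)
    (hF : ∀ᵐ t ∂nu, (F t).PosSemidef) (hG : ∀ᵐ t ∂nu, (G t).PosSemidef)
    (hu : ∀ᵐ t ∂nu, IsUnit (F t + G t)) : RowsL2 fun t => F t * Di t := by
  have hm := aemeasurable_mul (fun p q => (hFi p q).aemeasurable) h.aemeasurable_inv
  have hm' : ∀ p q, AEMeasurable (fun t => (F t * (F t + G t)⁻¹ * F t) p q) nu :=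
    aemeasurable_mul (aemeasurable_mul (fun p q => (hFi p q).aemeasurable)
      fun p q => (h.integrable_inv p q).aemeasurable) fun p q => (hFi p q).aemeasurable
  refine rowsL2_of_integrable hm fun q => ?_
  have hi : Integrable (fun t => (F t * (F t + G t)⁻¹ * F t) q q) nu := by
    refine (hFi q q).norm.mono' (hm' q q).aestronglyMeasurable ?_
    filter_upwards [hF, hG, hu, h.isHermitian_inv, h.mul_self_inv] with t hF hG hu h1 h2
    have h3 := (posSemidef_sub_mul_inv_mul_self hF hG hu).diag_nonneg (i := q)
    have h4 : 0 ≤ (F t * (F t + G t)⁻¹ * F t) q q := by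
      have : F t * (F t + G t)⁻¹ * F t = (F t * Di t) * (F t * Di t)ᴴ := by
        have h2' : Di t * Di t = (F t + G t)⁻¹ := h2
        rw [Matrix.conjTranspose_mul, h1, hF.1.eq, ← h2']
        noncomm_ring
      rw [this]
      exact (Matrix.posSemidef_self_mul_conjTranspose _).diag_nonneg
    rw [Matrix.sub_apply, sub_nonneg] at h3
    exact CStarAlgebra.norm_le_norm_of_nonneg_of_le h4 h3
  refine hi.congr ?_
  filter_upwards [hF, h.isHermitian_inv, h.mul_self_inv] with t hF h1 h2
  have h2' : Di t * Di t = (F t + G t)⁻¹ := h2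
  rw [Matrix.conjTranspose_mul, h1, hF.1.eq, ← h2']
  noncomm_ring

/-- The mean-square error as a quadratic expression in `L₂`. -/
theorem IsWeightRoot.mse_eq (h : IsWeightRoot (F + G) D Di)
    (hFi : ∀ p q, Integrable (fun t => F t p q) nu) (hGi : ∀ p q, Integrable (fun t => G t p q) nu)
    (hF : ∀ᵐ t ∂nu, (F t).PosSemidef) (hG : ∀ᵐ t ∂nu, (G t).PosSemidef)
    (hDF : RowsL2 DF) (hDF' : ∀ᵐ t ∂nu, (DF t).IsHermitian ∧ DF t * DF t = F t)
    (hM : RowsL2 fun t => F t * Di t) (x : ℤ →₀ (Fin T → ℂ)) {f : ℝ → Fin T → ℂ}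
    (hf : AEMeasurable f nu) {u : Lp (EuclideanSpace ℂ (Fin T)) 2 nu}
    (hu : ∀ᵐ t ∂nu, f t ᵥ* D t = (u t).ofLp) :
    mse F G (trigPoly x) f = inner ℂ (comb (rowVec DF hDF) x) (comb (rowVec DF hDF) x)
      - inner ℂ u (comb (rowVec _ hM) x) - inner ℂ (comb (rowVec _ hM) x) u + inner ℂ u u := by
  have hx : AEMeasurable (trigPoly x) nu := (continuous_trigPoly x).aemeasurable
  have i1 : Integrable (fun t => (trigPoly x t - f t) ⬝ᵥ (F t *ᵥ star (trigPoly x t - f t))) nu := by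
    refine h.integrable_quadratic (fun p q => (hFi p q).aemeasurable) hF hG (hx.sub hf)
      (u := comb (rowVec D h.rowsL2) x - u) ?_
    filter_upwards [hu, coeFn_comb_rowVec h.rowsL2 x, Lp.coeFn_sub (comb (rowVec D h.rowsL2) x) u]
      with t h1 h2 h3
    rw [h3, Pi.sub_apply, h2, Matrix.sub_vecMul, h1]
    rfl
  have hcomm : IsWeightRoot (G + F) D Di := by rwa [add_comm]
  have i2 : Integrable (fun t => f t ⬝ᵥ (G t *ᵥ star (f t))) nu :=
    hcomm.integrable_quadratic (fun p q => (hGi p q).aemeasurable) hG hF hf hu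
  rw [mse, mean_eq_integral, mean_eq_integral, ← integral_add i1 i2, L2.inner_def, L2.inner_def,
    L2.inner_def, L2.inner_def]
  have j := fun v w : Lp (EuclideanSpace ℂ (Fin T)) 2 nu => L2.integrable_inner (𝕜 := ℂ) v w
  have s1 := integral_sub (j (comb (rowVec DF hDF) x) (comb (rowVec DF hDF) x))
    (j u (comb (rowVec _ hM) x))
  have s2 := integral_sub ((j (comb (rowVec DF hDF) x) (comb (rowVec DF hDF) x)).sub
    (j u (comb (rowVec _ hM) x))) (j (comb (rowVec _ hM) x) u)
  have s3 := integral_add (((j (comb (rowVec DF hDF) x) (comb (rowVec DF hDF) x)).sub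
    (j u (comb (rowVec _ hM) x))).sub (j (comb (rowVec _ hM) x) u)) (j u u)
  simp only [Pi.sub_apply] at s1 s2 s3
  rw [← s1, ← s2, ← s3]
  refine integral_congr_ae ?_
  filter_upwards [hu, coeFn_comb_rowVec hDF x, coeFn_comb_rowVec hM x, hDF', hF, h.isHermitian,
    h.mul_self, h.isHermitian_inv, h.inv_mul] with t hu h1 h2 h3 hFt h4 h5 h6 h7
  -- `e1` to `e4` are the terms of the expanded form in `A - f`; the cross terms use `F Di D = F`,
  -- and the last absorbs the noise term since `D D = F + G`.
  have e1 : inner ℂ (comb (rowVec DF hDF) x t) (comb (rowVec DF hDF) x t) =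
      trigPoly x t ⬝ᵥ (F t *ᵥ star (trigPoly x t)) := by
    rw [h1, EuclideanSpace.inner_eq_star_dotProduct, dotProduct_mulVec_star h3.1 h3.2]
  have e2 : inner ℂ (u t) (comb (rowVec _ hM) x t) = trigPoly x t ⬝ᵥ (F t *ᵥ star (f t)) := by
    rw [h2, EuclideanSpace.inner_eq_star_dotProduct, ← hu, Matrix.star_vecMul, h4,
      ← Matrix.dotProduct_mulVec, Matrix.mulVec_mulVec, Matrix.mul_assoc, h7, Matrix.mul_one]
  have e3 : inner ℂ (comb (rowVec _ hM) x t) (u t) = f t ⬝ᵥ (F t *ᵥ star (trigPoly x t)) := by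
    rw [← inner_conj_symm, e2]
    change star _ = _
    rw [← Matrix.star_dotProduct_star, Matrix.star_mulVec, star_star, hFt.1.eq,
      ← Matrix.dotProduct_mulVec]
  have e4 : inner ℂ (u t) (u t) = f t ⬝ᵥ (F t *ᵥ star (f t)) + f t ⬝ᵥ (G t *ᵥ star (f t)) := by
    rw [EuclideanSpace.inner_eq_star_dotProduct, ← hu, ← dotProduct_mulVec_star h4 h5,
      Pi.add_apply, Matrix.add_mulVec, dotProduct_add]
  rw [e1, e2, e3, e4]
  simp only [star_sub, Matrix.mulVec_sub, dotProduct_sub, sub_dotProduct]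
  ring

end MeanSquareError

/-! ### Spectral characteristics under the isometry -/

section SpectralCharacteristic
variable {T : ℕ} {V D Di : ℝ → Matrix (Fin T) (Fin T) ℂ} {Ω : Type*} [MeasurableSpace Ω]
  {P : Measure Ω} {ζ : ℤ → Fin T → Lp ℂ 2 P}

theorem IsWeightRoot.weightedSq_sub_trigPoly (h : IsWeightRoot V D Di) {f : ℝ → Fin T → ℂ}
    {u : Lp (EuclideanSpace ℂ (Fin T)) 2 nu} (hu : ∀ᵐ t ∂nu, f t ᵥ* D t = (u t).ofLp)
    (p : ℤ →₀ (Fin T → ℂ)) :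
    weightedSq V (f - trigPoly p) =
      ENNReal.ofReal (2 * Real.pi * ‖u - comb (rowVec D h.rowsL2) p‖ ^ 2) := by
  rw [h.weightedSq_eq, ENNReal.ofReal_mul Real.two_pi_pos.le,
    ENNReal.ofReal_pow (norm_nonneg _), Lp.norm_def, ENNReal.ofReal_toReal (Lp.eLpNorm_ne_top _)]
  congr 2
  refine eLpNorm_congr_ae ?_
  filter_upwards [hu, coeFn_comb_rowVec h.rowsL2 p, Lp.coeFn_sub u (comb (rowVec D h.rowsL2) p)]
    with t h1 h2 h3
  rw [h3, Pi.sub_apply, Pi.sub_apply, h2, Matrix.sub_vecMul, h1]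
  rfl

theorem IsWeightRoot.aemeasurable_of_vecMul_eq (h : IsWeightRoot V D Di) {f : ℝ → Fin T → ℂ}
    {u : Lp (EuclideanSpace ℂ (Fin T)) 2 nu} (hu : ∀ᵐ t ∂nu, f t ᵥ* D t = (u t).ofLp) :
    AEMeasurable f nu := by
  have hm : AEMeasurable (fun t => (u t).ofLp ᵥ* Di t) nu :=
    aemeasurable_vecMul ((PiLp.continuous_ofLp 2 _).measurable.comp_aemeasurable
      (Lp.aestronglyMeasurable u).aemeasurable) h.aemeasurable_inv
  refine hm.congr ?_
  filter_upwards [hu, h.mul_inv] with t h1 h2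
  rw [← h1, Matrix.vecMul_vecMul, h2, Matrix.vecMul_one]

theorem aemeasurable_nu_iff {E : Type*} [MeasurableSpace E] {f : ℝ → E} :
    AEMeasurable f nu ↔ AEMeasurable f circ := by
  rw [nu]
  exact aemeasurable_smul_measure_iff (ENNReal.inv_ne_zero.2 ENNReal.ofReal_ne_top)

/-- The spectral characteristic of `y` is the function which corresponds to `y` under the isometry
`ζ(j,q) ↦ e^{i j t} δ_q`. -/
theorem IsWeightRoot.isSpectralChar_iff (h : IsWeightRoot V D Di) {I : Set ℤ}
    {f : ℝ → Fin T → ℂ} {u : Lp (EuclideanSpace ℂ (Fin T)) 2 nu}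
    (hu : ∀ᵐ t ∂nu, f t ᵥ* D t = (u t).ofLp)
    (huI : u ∈ (spanIdx (rowVec D h.rowsL2) I).topologicalClosure) {y : Lp ℂ 2 P}
    (hy : ∀ p, ‖y - comb ζ p‖ = ‖u - comb (rowVec D h.rowsL2) p‖) (g : ℝ → Fin T → ℂ) :
    IsSpectralChar V ζ I g y ↔ g =ᵐ[circ] f := by
  have hπ := Real.two_pi_pos
  constructor
  · rintro ⟨-, hgm, hg⟩
    have hgm' : AEMeasurable g nu := aemeasurable_nu_iff.2 hgm
    have hfm : AEMeasurable f nu := h.aemeasurable_of_vecMul_eq hu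
    have hmeas : ∀ {k : ℝ → Fin T → ℂ}, AEMeasurable k nu → AEStronglyMeasurable
        (fun t => (WithLp.toLp 2 (k t ᵥ* D t) : EuclideanSpace ℂ (Fin T))) nu := fun hk =>
      ((PiLp.continuous_toLp 2 _).measurable.comp_aemeasurable
        (aemeasurable_vecMul hk h.aemeasurable)).aestronglyMeasurable
    have hz : eLpNorm (fun t => (WithLp.toLp 2 ((g t - f t) ᵥ* D t) : EuclideanSpace ℂ (Fin T)))
        2 nu = 0 := by
      refine le_antisymm (ENNReal.le_of_forall_pos_le_add fun ε hε _ => ?_) zero_le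
      have hε' : (0 : ℝ) < ε := hε
      -- One polynomial `p` is `ε/2`-close to `g` by the weighted norm and to `f` through `y` and
      -- the isometry; the second entry of the minimum undoes the square and the factor `2π`.
      obtain ⟨p, hp1, hp2⟩ := hg (min ((ε : ℝ) / 2) (2 * Real.pi * ((ε : ℝ) / 2) ^ 2))
        (lt_min (by positivity) (by positivity))
      have hp : AEMeasurable (trigPoly p) nu := (continuous_trigPoly p).aemeasurable
      have e1 : eLpNorm (fun t => (WithLp.toLp 2 ((g - trigPoly p) t ᵥ* D t) :
          EuclideanSpace ℂ (Fin T))) 2 nu ≤ ENNReal.ofReal ((ε : ℝ) / 2) := by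
        have h1 := hp1.le.trans (ENNReal.ofReal_le_ofReal (min_le_right _ _))
        rw [h.weightedSq_eq, ENNReal.ofReal_mul hπ.le, ENNReal.mul_le_mul_iff_right
          (by simpa using Real.pi_pos) ENNReal.ofReal_ne_top,
          ENNReal.ofReal_pow (by positivity)] at h1
        exact (ENNReal.pow_le_pow_left_iff two_ne_zero).1 h1
      have e2 : eLpNorm (fun t => (WithLp.toLp 2 ((f - trigPoly p) t ᵥ* D t) :
          EuclideanSpace ℂ (Fin T))) 2 nu ≤ ENNReal.ofReal ((ε : ℝ) / 2) := by
        have h1 : ‖u - comb (rowVec D h.rowsL2) p‖ ≤ (ε : ℝ) / 2 := by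
          rw [← hy, comb_apply]
          exact hp2.le.trans (min_le_left _ _)
        have h2 := h.weightedSq_sub_trigPoly hu p
        rw [h.weightedSq_eq, ENNReal.ofReal_mul hπ.le] at h2
        have h3 := (ENNReal.mul_right_inj (by simpa using Real.pi_pos) ENNReal.ofReal_ne_top).1 h2
        rw [ENNReal.ofReal_pow (norm_nonneg _)] at h3
        have h4 := ENNReal.ofReal_le_ofReal h1
        exact (ENNReal.pow_le_pow_left_iff two_ne_zero).1
          (h3.le.trans (by gcongr))
      have e3 : (fun t => (WithLp.toLp 2 ((g t - f t) ᵥ* D t) : EuclideanSpace ℂ (Fin T))) =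
          (fun t => (WithLp.toLp 2 ((g - trigPoly p) t ᵥ* D t) : EuclideanSpace ℂ (Fin T))) -
          fun t => (WithLp.toLp 2 ((f - trigPoly p) t ᵥ* D t) : EuclideanSpace ℂ (Fin T)) := by
        funext t
        simp only [Pi.sub_apply, ← WithLp.toLp_sub, ← Matrix.sub_vecMul, sub_sub_sub_cancel_right]
      rw [e3, zero_add]
      refine (eLpNorm_sub_le (hmeas (hgm'.sub hp)) (hmeas (hfm.sub hp)) (by norm_num)).trans
        ((add_le_add e1 e2).trans ?_)
      rw [← ENNReal.ofReal_add (by positivity) (by positivity), add_halves,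
        ENNReal.ofReal_coe_nnreal]
    replace hz := (eLpNorm_eq_zero_iff (hmeas (hgm'.sub hfm)) two_ne_zero).1 hz
    refine ae_nu_iff.1 ?_
    filter_upwards [hz, h.mul_inv] with t h1 h2
    have h3 : (g t - f t) ᵥ* D t = 0 := congrArg WithLp.ofLp h1
    have h4 := congrArg (· ᵥ* Di t) h3
    simp only [Matrix.vecMul_vecMul, h2, Matrix.vecMul_one, Matrix.zero_vecMul] at h4
    exact sub_eq_zero.1 h4
  · intro hgf
    have hgu : ∀ᵐ t ∂nu, g t ᵥ* D t = (u t).ofLp := by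
      filter_upwards [hu, ae_nu_iff.2 hgf] with t h1 h2
      rw [h2, h1]
    have hgm : AEMeasurable g circ := aemeasurable_nu_iff.1 (h.aemeasurable_of_vecMul_eq hgu)
    have happrox : ∀ ε : ℝ, 0 < ε → ∃ p : ℤ →₀ (Fin T → ℂ), (p.support : Set ℤ) ⊆ I ∧
        weightedSq V (g - trigPoly p) < ENNReal.ofReal ε ∧ ‖y - comb ζ p‖ < ε := by
      intro ε hε
      -- By `hy` the same `p` approximates `g` in `L₂(V)` and `y` in `L₂(P)`.
      obtain ⟨p, hpI, hp⟩ := mem_closure_spanIdx.1 huI (min ε √(ε / (2 * Real.pi)))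
        (lt_min hε (Real.sqrt_pos.2 (by positivity)))
      refine ⟨p, hpI, ?_, ?_⟩
      · rw [h.weightedSq_sub_trigPoly hgu, ENNReal.ofReal_lt_ofReal_iff hε]
        have h1 := hp.trans_le (min_le_right _ _)
        rw [Real.lt_sqrt (norm_nonneg _), lt_div_iff₀ hπ] at h1
        linarith
      · rw [hy]
        exact hp.trans_le (min_le_left _ _)
    refine ⟨⟨hgm, fun ε hε => ?_⟩, hgm, fun ε hε => ?_⟩
    · rcases eq_or_ne ε ⊤ with rfl | hε'
      · obtain ⟨p, hpI, hp, -⟩ := happrox 1 one_pos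
        exact ⟨p, hpI, hp.trans ENNReal.ofReal_lt_top⟩
      · obtain ⟨p, hpI, hp, -⟩ := happrox ε.toReal (ENNReal.toReal_pos hε.ne' hε')
        rw [ENNReal.ofReal_toReal hε'] at hp
        exact ⟨p, hpI, hp⟩
    · obtain ⟨p, -, hp, hp'⟩ := happrox ε hε
      rw [comb_apply] at hp'
      exact ⟨p, hp, hp'⟩

end SpectralCharacteristic

/-! ### `B`, `R`, `Q` and the spectral formula in the model -/

section Blocks
variable {T : ℕ} {F G D Di DF : ℝ → Matrix (Fin T) (Fin T) ℂ}

theorem IsWeightRoot.blockB_eq (h : IsWeightRoot (F + G) D Di) (k j : ℤ) (q p : Fin T) :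
    blockB F G k j q p = inner ℂ (rowVec Di h.rowsL2_inv k p) (rowVec Di h.rowsL2_inv j q) := by
  rw [inner_rowVec_rowVec]
  change fourierCo _ _ = _
  refine mean_congr ?_
  filter_upwards [h.isHermitian_inv, h.mul_self_inv] with t h1 h2
  have h2' : Di t * Di t = (F t + G t)⁻¹ := h2
  rw [h1, h2', mul_comm, neg_sub]

/-- The sign in `-j` reflects that the functional involves `ξ(-j)`; the rows of `F Di` represent the
correlations of `ξ` with `ξ + η`. -/
theorem IsWeightRoot.blockR_eq (h : IsWeightRoot (F + G) D Di)
    (hM : RowsL2 fun t => F t * Di t) (k j : ℤ) (q p : Fin T) :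
    blockR F G k j q p = inner ℂ (rowVec Di h.rowsL2_inv k p) (rowVec _ hM (-j) q) := by
  rw [inner_rowVec_rowVec]
  change fourierCo _ _ = _
  refine mean_congr ?_
  filter_upwards [h.isHermitian_inv, h.mul_self_inv] with t h1 h2
  have h2' : Di t * Di t = (F t + G t)⁻¹ := h2
  rw [h1, Matrix.mul_assoc, h2', mul_comm]
  congr 2
  ring

/-- `F (F + G)⁻¹ G = F - F (F + G)⁻¹ F`, a difference of two Gram symbols. -/
theorem IsWeightRoot.blockQ_eq (h : IsWeightRoot (F + G) D Di)
    (hF : ∀ᵐ t ∂nu, (F t).PosSemidef) (hu : ∀ᵐ t ∂nu, IsUnit (F t + G t))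
    (hDF : RowsL2 DF) (hDF' : ∀ᵐ t ∂nu, (DF t).IsHermitian ∧ DF t * DF t = F t)
    (hM : RowsL2 fun t => F t * Di t) (k j : ℤ) (p q : Fin T) :
    blockQ F G k j p q = inner ℂ (rowVec DF hDF (-j) q) (rowVec DF hDF (-k) p) -
      inner ℂ (rowVec _ hM (-j) q) (rowVec _ hM (-k) p) := by
  rw [inner_rowVec_rowVec, inner_rowVec_rowVec, mean_eq_integral, mean_eq_integral,
    ← integral_sub (integrable_ex_mul (integrable_mul_conjTranspose hDF hDF q p) _)
      (integrable_ex_mul (integrable_mul_conjTranspose hM hM q p) _), ← mean_eq_integral]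
  change fourierCo _ _ = _
  refine mean_congr ?_
  filter_upwards [hF, hu, hDF', h.isHermitian_inv, h.mul_self_inv] with t hF hu h3 h1 h2
  have h2' : Di t * Di t = (F t + G t)⁻¹ := h2
  have e : F t * Di t * (F t * Di t)ᴴ = F t * (F t + G t)⁻¹ * F t := by
    rw [Matrix.conjTranspose_mul, h1, hF.1.eq, ← h2']
    noncomm_ring
  rw [e, h3.1.eq, h3.2, ← mul_sub, ← Matrix.sub_apply, sub_mul_inv_mul_self_eq hu, mul_comm]
  congr 2
  ring

theorem IsWeightRoot.quadForm_blockQ_eq (h : IsWeightRoot (F + G) D Di)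
    (hF : ∀ᵐ t ∂nu, (F t).PosSemidef) (hu : ∀ᵐ t ∂nu, IsUnit (F t + G t))
    (hDF : RowsL2 DF) (hDF' : ∀ᵐ t ∂nu, (DF t).IsHermitian ∧ DF t * DF t = F t)
    (hM : RowsL2 fun t => F t * Di t) (x : ℤ →₀ (Fin T → ℂ)) :
    quadForm (blockQ F G) x =
      inner ℂ (comb (rowVec DF hDF) (reflect x)) (comb (rowVec DF hDF) (reflect x)) -
      inner ℂ (comb (rowVec _ hM) (reflect x)) (comb (rowVec _ hM) (reflect x)) := by
  let X₁ : ℤ → ℤ → Matrix (Fin T) (Fin T) ℂ := fun k j => Matrix.of fun p q =>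
    inner ℂ (rowVec DF hDF (-j) q) (rowVec DF hDF (-k) p)
  let X₂ : ℤ → ℤ → Matrix (Fin T) (Fin T) ℂ := fun k j => Matrix.of fun p q =>
    inner ℂ (rowVec _ hM (-j) q) (rowVec _ hM (-k) p)
  have e : blockQ F G = X₁ - X₂ := by
    funext k j
    ext p q
    exact h.blockQ_eq hF hu hDF hDF' hM k j p q
  have h1 : quadForm X₁ x = _ :=
    quadForm_eq_inner (e := fun j => rowVec DF hDF (-j)) (fun _ _ _ _ => rfl) x
  have h2 : quadForm X₂ x = _ :=
    quadForm_eq_inner (e := fun j => rowVec _ hM (-j)) (fun _ _ _ _ => rfl) x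
  rw [e, quadForm_sub, h1, h2, comb_reflect, comb_reflect]

/-- Multiplication by `D` turns the formula into `φ - ψ`, because `F (F + G)⁻¹ D = F Di` and `D (F +
G)⁻¹ D = 1`. -/
theorem IsWeightRoot.specFormula_vecMul (h : IsWeightRoot (F + G) D Di)
    (hM : RowsL2 fun t => F t * Di t) (x : ℤ →₀ (Fin T → ℂ))
    (ψ : Lp (EuclideanSpace ℂ (Fin T)) 2 nu) :
    ∀ᵐ t ∂nu, specFormula F G (trigPoly x) (fun t => (ψ t).ofLp ᵥ* D t) t ᵥ* D t =
      ((comb (rowVec _ hM) x - ψ : Lp (EuclideanSpace ℂ (Fin T)) 2 nu) t).ofLp := by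
  filter_upwards [coeFn_comb_rowVec hM x, Lp.coeFn_sub (comb (rowVec _ hM) x) ψ, h.mul_self_inv,
    h.inv_mul, h.mul_inv] with t h1 h2 h3 h4 h5
  have h3' : Di t * Di t = (F t + G t)⁻¹ := h3
  rw [h2, Pi.sub_apply, h1, specFormula, Matrix.sub_vecMul, Matrix.vecMul_vecMul,
    Matrix.vecMul_vecMul, Matrix.vecMul_vecMul, ← h3']
  have e1 : F t * (Di t * Di t) * D t = F t * Di t := by
    rw [Matrix.mul_assoc, Matrix.mul_assoc, h4, mul_one]
  have e2 : D t * (Di t * Di t * D t) = 1 := by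
    rw [Matrix.mul_assoc, h4, mul_one, h5]
  rw [e1, e2, Matrix.vecMul_one]
  rfl

end Blocks

theorem isOptimalEstimate_unique {T : ℕ} {Ω : Type*} [MeasurableSpace Ω] {P : Measure Ω}
    {ζ : ℤ → Fin T → Lp ℂ 2 P} {I : Set ℤ} {x y : Lp ℂ 2 P} (hy : y ∈ obsSpace ζ I)
    (horth : ∀ z ∈ obsSpace ζ I, inner ℂ z (x - y) = 0) :
    IsOptimalEstimate ζ I x y ∧ ∀ y', IsOptimalEstimate ζ I x y' → y' = y := by
  have hpyth : ∀ z ∈ obsSpace ζ I, ‖x - z‖ * ‖x - z‖ = ‖y - z‖ * ‖y - z‖ + ‖x - y‖ * ‖x - y‖ := by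
    intro z hz
    have h := norm_add_sq_eq_norm_sq_add_norm_sq_of_inner_eq_zero (y - z) (x - y)
      (horth _ (Submodule.sub_mem _ hy hz))
    rwa [sub_add_sub_comm, add_comm y x, add_sub_add_right_eq_sub] at h
  refine ⟨⟨hy, fun z hz => ?_⟩, fun y' hy' => ?_⟩
  · have := hpyth z hz
    refine nonneg_le_nonneg_of_sq_le_sq (norm_nonneg _) ?_
    nlinarith [mul_self_nonneg ‖y - z‖]
  · have h1 := hpyth y' hy'.1
    have h2 := hy'.2 y hy
    have h3 : ‖x - y'‖ * ‖x - y'‖ ≤ ‖x - y‖ * ‖x - y‖ := mul_self_le_mul_self (norm_nonneg _) h2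
    have h4 : ‖y - y'‖ = 0 := by nlinarith [norm_nonneg (y - y')]
    exact (sub_eq_zero.1 (norm_eq_zero.1 h4)).symm

end Filtering

end

/-! ### The estimation theorem -/

theorem corollary3 {T s : ℕ} {Ω : Type*} [MeasurableSpace Ω] (P : Measure Ω)
    [IsProbabilityMeasure P]
    (M L : Fin s → ℕ) (N : ℕ)
    (F G : ℝ → Matrix (Fin T) (Fin T) ℂ) (ξ η : ℤ → Fin T → Lp ℂ 2 P)
    (hξ : IsStationary P ξ F) (hη : IsStationary P η G)
    (hξη : Uncorrelated ξ η) (hmin : Minimality F G)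
    (a : ℤ → Fin T → ℂ) :
    ∃ (c : ℤ → Fin T → ℂ) (r : ℂ) (C : ℝ → Fin T → ℂ) (Y : Lp ℂ 2 P),
      -- `c = B⁻¹ R a_N` and `r = ⟨R a_N, B⁻¹ R a_N⟩` exist and are uniquely determined
      IsInverseImage (blockB F G) (unobsIdx M L)
        (blockApply (blockR F G) (truncVec M L N a)) c r ∧
      (∀ c' r', IsInverseImage (blockB F G) (unobsIdx M L)
        (blockApply (blockR F G) (truncVec M L N a)) c' r' →
          c' = c ∧ r' = r) ∧
      -- `C` is the sum of `c(k) e^{ikt}` over `k ∈ U`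
      IsFourierSum C c ∧
      -- `Y` is the optimal linear estimate of `A_N ξ`
      IsOptimalEstimate (ξ + η) (obsIdx M L)
        (functional M L N a ξ) Y ∧
      (∀ Y', IsOptimalEstimate (ξ + η) (obsIdx M L)
        (functional M L N a ξ) Y' → Y' = Y) ∧
      -- its spectral characteristic is given by the formula, up to null sets
      (∀ h : ℝ → Fin T → ℂ,
        IsSpectralChar (F + G) (ξ + η) (obsIdx M L) h Y ↔
          h =ᵐ[circ] specFormula F G (symbolA M L N a) C) ∧
      -- its mean-square error
      ((‖functional M L N a ξ - Y‖ ^ 2 : ℝ) : ℂ) =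
        mse F G (symbolA M L N a)
          (specFormula F G (symbolA M L N a) C) ∧
      ((‖functional M L N a ξ - Y‖ ^ 2 : ℝ) : ℂ) =
        r + quadForm (blockQ F G) (truncVec M L N a) ∧
      -- if the matrix of `B` defines a bounded operator of `ℓ₂` with a bounded inverse, then
      -- `c` and `r` are obtained from this inverse and from the inner product of `ℓ₂`
      (∀ E : SeqL2 T (unobsIdx M L) ≃L[ℂ]
          SeqL2 T (unobsIdx M L),
        HasBlocks (blockB F G) E.toContinuousLinearMap →
        ∃ y : SeqL2 T (unobsIdx M L),
          (∀ k, (y k).ofLp = blockApply (blockR F G)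
            (truncVec M L N a) k) ∧
          (∀ k, (E.symm y k).ofLp = c k) ∧
          inner ℂ (E.symm y) y = r) := by
  have hFi : ∀ p q, Integrable (fun t => F t p q) nu := fun p q =>
    integrable_nu_iff.2 (hξ.density.integrable p q)
  have hGi : ∀ p q, Integrable (fun t => G t p q) nu := fun p q =>
    integrable_nu_iff.2 (hη.density.integrable p q)
  have hF : ∀ᵐ t ∂nu, (F t).PosSemidef := ae_nu_iff.2 hξ.density.posSemidef
  have hG : ∀ᵐ t ∂nu, (G t).PosSemidef := ae_nu_iff.2 hη.density.posSemidef
  have hunit : ∀ᵐ t ∂nu, IsUnit (F t + G t) := ae_nu_iff.2 hmin.1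
  obtain ⟨D, Di, h⟩ := exists_isWeightRoot (V := F + G) (fun p q => (hFi p q).add (hGi p q))
    (by filter_upwards [hF, hG] with t h1 h2 using h1.add h2) hunit
    (fun p q => integrable_nu_iff.2 (hmin.2 p q))
  obtain ⟨DF, hDFm, hDF'⟩ := exists_measurable_sqrt (fun p q => (hFi p q).aemeasurable) hF
  have hDF : RowsL2 DF := rowsL2_of_integrable hDFm fun q => (hFi q q).congr (by
    filter_upwards [hDF'] with t ht
    rw [ht.1.eq, ht.2])
  have hM := h.rowsL2_mul hFi hF hG hunit
  set aN := truncVec M L N a with haN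
  set x := reflect aN with hx
  -- `φ` carries the inner products of `A_N ξ` with `ξ + η`, while `δ` carries only its norm; in
  -- general `‖φ‖ ≤ ‖δ‖`.
  set φ := comb (rowVec _ hM) x with hφ
  set δ := comb (rowVec DF hDF) x with hδ
  obtain ⟨ψ, hψ, hφψ⟩ := exists_orthogonal_decomposition (rowVec D h.rowsL2) (obsIdx M L) φ
  have hcompl := compl_unobsIdx M L
  have hX := fun x k p => blockApply_eq_inner h.blockB_eq x k p
  have hy : ∀ k p, blockApply (blockR F G) aN k p = inner ℂ (rowVec Di h.rowsL2_inv k p) φ :=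
    fun k p => by
      rw [blockApply_eq_inner (h.blockR_eq hM), hφ, hx, comb_reflect]
  obtain ⟨hinv, huniq⟩ := isInverseImage_of_biorthogonal (U := unobsIdx M L) (φ := φ) (ψ := ψ)
    h.biorthogonal (fun f g hg hf => h.inner_eq_zero (fun k hk => Or.inr hk)
      (finite_unobsIdx_neg M L) hg hf) hX hy (by rwa [hcompl]) (by rwa [hcompl])
  have hA : symbolA M L N a = trigPoly x := funext fun t => symbolA_eq_trigPoly M L N a t
  have hX₀ : functional M L N a ξ = comb ξ x := functional_eq_comb M L N a ξ
  have hζ : ∀ i p j q, inner ℂ ((ξ + η) i p) ((ξ + η) j q) =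
      inner ℂ (rowVec D h.rowsL2 i p) (rowVec D h.rowsL2 j q) := fun i p j q => by
    rw [inner_add_of_uncorrelated hξ hη hξη, inner_rowVec_rowVec]
    refine mean_congr ?_
    filter_upwards [h.isHermitian, h.mul_self] with t h1 h2
    rw [h1, h2]
    rfl
  -- The `η` part drops out, and `F = (F Di) D` identifies the remaining covariance.
  have hζx : ∀ j q, inner ℂ ((ξ + η) j q) (comb ξ x) = inner ℂ (rowVec D h.rowsL2 j q) φ :=
    fun j q => by
      rw [hφ, inner_comb_right, inner_comb_right]
      refine Finsupp.sum_congr fun i _ => Finset.sum_congr rfl fun p _ => ?_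
      rw [Pi.add_apply, Pi.add_apply, inner_add_left, hξη.inner_right, add_zero, hξ.inner_eq,
        inner_rowVec_rowVec]
      congr 1
      refine mean_congr ?_
      filter_upwards [h.isHermitian, h.inv_mul] with t h1 h2
      rw [h1, Matrix.mul_assoc, h2, mul_one]
  obtain ⟨Y, hYmem, hYorth, hYnorm⟩ := exists_isometric_projection hζ hζx hψ hφψ
  obtain ⟨hopt, hoptu⟩ := isOptimalEstimate_unique hYmem hYorth
  have hf := h.specFormula_vecMul hM x ψ
  have hfm := h.aemeasurable_of_vecMul_eq hf
  have hδn : ‖comb ξ x‖ = ‖δ‖ := norm_comb_congr (fun i p j q => by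
    rw [hξ.inner_eq, inner_rowVec_rowVec]
    refine mean_congr ?_
    filter_upwards [hDF'] with t ht
    rw [ht.1.eq, ht.2]) x
  have hYn : ‖Y‖ = ‖φ - ψ‖ := by simpa using hYnorm 0
  have hperp : inner ℂ (φ - ψ) ψ = 0 := inner_eq_zero_of_mem_closure_spanIdx hφψ hψ
  have hperp' : inner ℂ ψ (φ - ψ) = 0 := by rw [← inner_conj_symm, hperp, map_zero]
  have herr : ((‖comb ξ x - Y‖ ^ 2 : ℝ) : ℂ) = inner ℂ δ δ - inner ℂ (φ - ψ) (φ - ψ) := by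
    have h1 := norm_add_sq_eq_norm_sq_add_norm_sq_of_inner_eq_zero Y (comb ξ x - Y)
      (hYorth Y hYmem)
    rw [add_sub_cancel, hδn, hYn] at h1
    rw [← ofReal_norm_sq_eq_inner, ← ofReal_norm_sq_eq_inner, ← Complex.ofReal_sub]
    congr 1
    linarith
  have hφeq : φ = (φ - ψ) + ψ := (sub_add_cancel φ ψ).symm
  -- `C = ψ D` is integrable as a product of square integrable factors, and its coefficients are the
  -- coordinates `⟨α(k,p), ψ⟩`.
  refine ⟨_, _, fun t => (ψ t).ofLp ᵥ* D t, Y, hinv, huniq, fun l => ⟨?_, fun k => ?_⟩, ?_, ?_, ?_,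
    ?_, ?_, fun E hE => hinv.eq_symm_apply (fun x _ => ?_) E hE⟩
  · refine integrable_nu_iff.1 ((integrable_vecMul h.rowsL2 l ψ).congr ?_)
    filter_upwards [h.isHermitian] with t ht
    rw [ht]
  · refine Eq.trans ?_ (inner_rowVec h.rowsL2 k l ψ).symm
    refine mean_congr ?_
    filter_upwards [h.isHermitian] with t ht
    rw [ht]
  · rw [hX₀]
    exact hopt
  · rw [hX₀]
    exact hoptu
  · rw [hA]
    exact h.isSpectralChar_iff hf hφψ hYnorm
  · rw [hX₀, hA, h.mse_eq hFi hGi hF hG hDF hDF' hM x hfm hf, herr]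
    -- As `φ - ψ` is the projection of `φ`, both cross terms of the error equal its squared norm.
    have e1 : inner ℂ (φ - ψ) φ = inner ℂ (φ - ψ) (φ - ψ) := by
      rw [inner_sub_right, hperp, sub_zero]
    have e2 : inner ℂ φ (φ - ψ) = inner ℂ (φ - ψ) (φ - ψ) := by
      rw [← inner_conj_symm, e1, inner_conj_symm]
    rw [e1, e2]
    ring
  · have hq := h.quadForm_blockQ_eq hF hunit hDF hDF' hM aN
    have hφφ : inner ℂ φ φ = inner ℂ (φ - ψ) (φ - ψ) + inner ℂ ψ ψ := by
      conv_lhs => rw [hφeq]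
      rw [inner_add_left, inner_add_right, inner_add_right, hperp, hperp']
      ring
    rw [hX₀, herr, hq, hφφ, ofReal_norm_sq_eq_inner]
    ring
  · rw [pairing_blockApply_self hX]
    exact Complex.zero_le_real.2 (sq_nonneg _)
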